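/- **Orthogonal Vectors.** For integers $n,d\ge 1$, an instance $x$ of Orthogonal Vectors is a list $v_1,\dots,v_n$ of vectors in $\{0,1\}^d$. A solution is a pair $(i,j)$ of distinct positions with $\langle v_i,v_j\rangle=0$. The canonical solution $c(x)$ of a solvable instance $x$ is its lexicographically first solution. **Pseudo-deterministic MA proofs.** A $(t_1,t_2)$ pseudo-deterministic MA proof with canonical solutions $c$ consists of a probabilistic verifier algorithm $V$ and a probabilistic prover algorithm $P$. The prover, on input $x$, sends a single message $m$ (a bit string), chosen independently of the coins of $V$. Then $V$ runs on $x$ and $m$ with its own random coins and outputs a pair $(i,j)$ or $\bot$. The following are required. 1. For every $x$, the running time of $V$ is at most $t_1(x)$ for all messages and all coin tosses, and the running time of $P$ is at most $t_2(x)$ for all coin tosses. 2. (Canonical completeness) For every solvable $x$, when the message is produced by $P$ on input $x$, $V$ outputs $c(x)$ with probability at least $2/3$ over the coins of $P$ and $V$. 3. (Canonical soundness) For every solvable $x$ and every message $m$, $V$ outputs $c(x)$ or $\bot$ with probability at least $2/3$. 4. (Standard soundness) For every $x$ without a solution and every message $m$, $V$ outputs something other than $\bot$ with probability at most $1/3$.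 Algorithms are programs, fixed for all $n$ and $d$, of a random access machine with coin tossing, whose steps are charged according to the bit lengths of the numbers and addresses involved; $\tilde O(f)$ means at most $C\,f\,(1+\log f)^k$ for some constants $C,k$. **Theorem.** Orthogonal Vectors has a $(\tilde O(nd),\tilde O(n^2d^2))$ pseudo-deterministic MA proof whose canonical solution is the lexicographically first orthogonal pair. -/

import Mathlib

open MeasureTheory
open scoped ENNReal

/-! ## A probabilistic random access machine with logarithmic cost

A program works on finitely many unbounded arrays of natural numbers, named `0, 1, 2, …`.
Programs are finite syntax trees, so one program handles inputs of every size.  Every step is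
charged at least the number of bits of all the numbers and addresses that it handles; an arithmetic
operation is charged the product of the operand lengths, which covers the schoolbook algorithms. -/

/-- Binary operations of the machine. -/
inductive Op
  | add | sub | mul | div | mod | eq | lt

/-- The value of an operation (`sub` is truncated; tests return `0` or `1`). -/
def Op.eval : Op → ℕ → ℕ → ℕ
  | .add, x, y => x + y
  | .sub, x, y => x - y
  | .mul, x, y => x * y
  | .div, x, y => x / y
  | .mod, x, y => x % y
  | .eq, x, y => if x = y then 1 else 0
  | .lt, x, y => if x < y then 1 else 0

/-- Expressions: constants, the content of cell `i` of array `a`, and operations. -/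
inductive Expr
  | lit (k : ℕ)
  | get (a : ℕ) (i : Expr)
  | op (o : Op) (e₁ e₂ : Expr)

/-- Value of an expression; `m a i` is the content of cell `i` of array `a`. -/
def Expr.eval (m : ℕ → ℕ → ℕ) : Expr → ℕ
  | .lit k => k
  | .get a i => m a (i.eval m)
  | .op o e₁ e₂ => o.eval (e₁.eval m) (e₂.eval m)

/-- Time for evaluating an expression (`Nat.size x` is the number of binary digits of `x`). -/
def Expr.cost (m : ℕ → ℕ → ℕ) : Expr → ℕ
  | .lit k => k.size + 1
  | .get a i => i.cost m + (i.eval m).size + (m a (i.eval m)).size + 1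
  | .op _ e₁ e₂ =>
      e₁.cost m + e₂.cost m + ((e₁.eval m).size + 1) * ((e₂.eval m).size + 1)

/-- Commands. `set a i e` stores `e` in cell `i` of array `a`; `flip a i` stores a fresh random bit
there; `write e` appends `e` to the output tape; a condition is true when it is nonzero. -/
inductive Cmd
  | skip
  | set (a : ℕ) (i e : Expr)
  | flip (a : ℕ) (i : Expr)
  | write (e : Expr)
  | seq (c₁ c₂ : Cmd)
  | ite (e : Expr) (c₁ c₂ : Cmd)
  | while (e : Expr) (c : Cmd)

/-- Machine states: memory, number of coins tossed so far, and output tape. -/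
structure State where
  mem : ℕ → ℕ → ℕ
  pos : ℕ
  out : List ℕ

/-- Overwrite cell `i` of array `a` by `x`. -/
def State.store (s : State) (a i x : ℕ) : State :=
  { s with mem := Function.update s.mem a (Function.update (s.mem a) i x) }

/-- `Exec ω c s s' t`: with coin tosses `ω 0, ω 1, …`, the program `c`, started in state `s`, halts
in state `s'` after time `t`. -/
inductive Exec (ω : ℕ → Bool) : Cmd → State → State → ℕ → Prop
  | skip (s : State) : Exec ω .skip s s 1
  | set (a : ℕ) (i e : Expr) (s : State) :
      Exec ω (.set a i e) s (s.store a (i.eval s.mem) (e.eval s.mem))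
        (i.cost s.mem + e.cost s.mem + (i.eval s.mem).size + (e.eval s.mem).size + 1)
  | flip (a : ℕ) (i : Expr) (s : State) :
      Exec ω (.flip a i) s
        { s.store a (i.eval s.mem) (ω s.pos).toNat with pos := s.pos + 1 }
        (i.cost s.mem + (i.eval s.mem).size + 2)
  | write (e : Expr) (s : State) :
      Exec ω (.write e) s { s with out := s.out ++ [e.eval s.mem] }
        (e.cost s.mem + (e.eval s.mem).size + 1)
  | seq {c₁ c₂ : Cmd} {s₁ s₂ s₃ : State} {t₁ t₂ : ℕ} :
      Exec ω c₁ s₁ s₂ t₁ → Exec ω c₂ s₂ s₃ t₂ → Exec ω (.seq c₁ c₂) s₁ s₃ (t₁ + t₂)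
  | ite_true {e : Expr} {c₁ c₂ : Cmd} {s s' : State} {t : ℕ} :
      e.eval s.mem ≠ 0 → Exec ω c₁ s s' t → Exec ω (.ite e c₁ c₂) s s' (e.cost s.mem + t + 1)
  | ite_false {e : Expr} {c₁ c₂ : Cmd} {s s' : State} {t : ℕ} :
      e.eval s.mem = 0 → Exec ω c₂ s s' t → Exec ω (.ite e c₁ c₂) s s' (e.cost s.mem + t + 1)
  | while_true {e : Expr} {c : Cmd} {s₁ s₂ s₃ : State} {t₁ t₂ : ℕ} :
      e.eval s₁.mem ≠ 0 → Exec ω c s₁ s₂ t₁ → Exec ω (.while e c) s₂ s₃ t₂ →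
      Exec ω (.while e c) s₁ s₃ (e.cost s₁.mem + t₁ + t₂ + 1)
  | while_false {e : Expr} {c : Cmd} {s : State} :
      e.eval s.mem = 0 → Exec ω (.while e c) s s (e.cost s.mem + 1)

/-- For given coin tosses a run is unique, so that its result and its time are well defined. -/
theorem Exec.unique {ω : ℕ → Bool} {c : Cmd} {s s₁ s₂ : State} {t₁ t₂ : ℕ}
    (h₁ : Exec ω c s s₁ t₁) (h₂ : Exec ω c s s₂ t₂) : s₁ = s₂ ∧ t₁ = t₂ := by
  induction h₁ generalizing s₂ t₂ with
  | skip | set | flip | write => cases h₂; exact ⟨rfl, rfl⟩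
  | seq _ _ ih₁ ih₂ =>
    cases h₂ with
    | seq k₁ k₂ =>
      obtain ⟨rfl, rfl⟩ := ih₁ k₁
      obtain ⟨rfl, rfl⟩ := ih₂ k₂
      exact ⟨rfl, rfl⟩
  | ite_true h _ ih =>
    cases h₂ with
    | ite_true _ k => obtain ⟨rfl, rfl⟩ := ih k; exact ⟨rfl, rfl⟩
    | ite_false h' _ => exact absurd h' h
  | ite_false h _ ih =>
    cases h₂ with
    | ite_true h' _ => exact absurd h h'
    | ite_false _ k => obtain ⟨rfl, rfl⟩ := ih k; exact ⟨rfl, rfl⟩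
  | while_true h _ _ ih₁ ih₂ =>
    cases h₂ with
    | while_true _ k₁ k₂ =>
      obtain ⟨rfl, rfl⟩ := ih₁ k₁
      obtain ⟨rfl, rfl⟩ := ih₂ k₂
      exact ⟨rfl, rfl⟩
    | while_false h' => exact absurd h' h
  | while_false h =>
    cases h₂ with
    | while_true h' _ _ => exact absurd h h'
    | while_false _ => exact ⟨rfl, rfl⟩

/-- The initial state: the input is in array `0`, the received message, one bit per cell, is in
array `1`, and everything else is `0`. -/
def initState (input : List ℕ) (msg : List Bool) : State where
  mem a i := if a = 0 then input.getD i 0 else if a = 1 then (msg.getD i false).toNat else 0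
  pos := 0
  out := []

/-- With coin tosses `ω`, the program halts on the given input and message with output `y`. -/
def Outputs (ω : ℕ → Bool) (c : Cmd) (input : List ℕ) (msg : List Bool) (y : List ℕ) : Prop :=
  ∃ s t, Exec ω c (initState input msg) s t ∧ s.out = y

/-- With coin tosses `ω`, the program halts on the given input and message within time `T`. -/
def HaltsWithin (ω : ℕ → Bool) (c : Cmd) (input : List ℕ) (msg : List Bool) (T : ℕ) : Prop :=
  ∃ s t, Exec ω c (initState input msg) s t ∧ t ≤ T

/-- The bit string sent by a prover whose output tape is `y`. -/
def toMessage (y : List ℕ) : List Bool := y.map fun k => decide (k ≠ 0)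

/-- The law of a sequence of independent fair coin tosses. -/
noncomputable def coins : Measure (ℕ → Bool) :=
  Measure.infinitePi fun _ => (PMF.uniformOfFintype Bool).toMeasure

/-! ## Pseudo-deterministic MA proofs -/

/-- `f · polylog f`: the functions `t` with `t ≤ C · f · (log f)^k` for some constants `C` and `k`
(the logarithm being increased by `1`). -/
def SoftO {X : Type*} (f : X → ℕ) : Set (X → ℕ) :=
  {t | ∃ C k : ℕ, ∀ x, t x ≤ C * f x * (Nat.log 2 (f x) + 1) ^ k}

/-- The search problem `R` (with inputs given to machines through `enc`, and with outputs of the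
verifier read through `dec`, where `none` is the reject symbol `⊥`) has a pseudo-deterministic
MA proof with canonical solutions `c`, verifier time `t₁` and prover time `t₂`.

The prover `P` sends one message, depending on the input and on the prover's own coins; then the
verifier `V` tosses its coins and computes its output. A cheating prover is an arbitrary message;
a randomized one is a mixture of these. -/
def HasPsdMAProof {X Y : Type*} (enc : X → List ℕ) (dec : List ℕ → Option Y)
    (R : X → Y → Prop) (c : X → Y) (t₁ t₂ : X → ℕ) : Prop :=
  (∀ x, (∃ y, R x y) → R x (c x)) ∧
  ∃ V P : Cmd,
    -- running times, for all coin tosses and, in the case of the verifier, all messages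
    (∀ x msg ω, HaltsWithin ω V (enc x) msg (t₁ x)) ∧
    (∀ x ω, HaltsWithin ω P (enc x) [] (t₂ x)) ∧
    -- canonical completeness
    (∀ x, (∃ y, R x y) → 2 / 3 ≤ (coins.prod coins) {ω | ∃ z o,
      Outputs ω.1 P (enc x) [] z ∧ Outputs ω.2 V (enc x) (toMessage z) o ∧
        dec o = some (c x)}) ∧
    -- canonical soundness
    (∀ x, (∃ y, R x y) → ∀ msg, 2 / 3 ≤ coins {ω | ∃ o,
      Outputs ω V (enc x) msg o ∧ (dec o = some (c x) ∨ dec o = none)}) ∧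
    -- standard soundness
    (∀ x, (¬ ∃ y, R x y) → ∀ msg, coins {ω | ∃ o,
      Outputs ω V (enc x) msg o ∧ dec o ≠ none} ≤ 1 / 3)

/-! ## Orthogonal Vectors -/

/-- A list of `n` vectors in `{0,1}^d`. -/
structure OVInstance where
  n : ℕ
  d : ℕ
  n_pos : 0 < n
  d_pos : 0 < d
  vec : Fin n → Fin d → Bool

/-- The machine input: `n`, `d`, and then the vectors one after the other. -/
def OVInstance.encode (x : OVInstance) : List ℕ :=
  x.n :: x.d :: List.ofFn fun k : Fin (x.n * x.d) => (x.vec k.divNat k.modNat).toNat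

/-- The inner product of the `i`-th and the `j`-th vector. -/
def OVInstance.inner (x : OVInstance) (i j : Fin x.n) : ℕ :=
  ∑ k, (x.vec i k).toNat * (x.vec j k).toNat

/-- The search problem: a solution is a pair of (different) positions, counted from `0`, of the
list that carry orthogonal vectors. Pairs are ordered lexicographically. -/
def OrthogonalVectors (x : OVInstance) (y : ℕ ×ₗ ℕ) : Prop :=
  ∃ i j : Fin x.n, i ≠ j ∧ x.inner i j = 0 ∧ y = toLex ((i : ℕ), (j : ℕ))

/-- The verifier outputs a pair by writing its two entries; any other output means `⊥`. -/
def decodePair : List ℕ → Option (ℕ ×ₗ ℕ)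
  | [i, j] => some (toLex (i, j))
  | _ => none

/-! ## Expressions: notation and cost -/

/-! Put `N = n * d` and work modulo a prime `p`. For each coordinate `k` let `X_k` be the polynomial
of degree less than `n` with `X_k(i) = v i k` at the rows `i < n`, and let `P = ∑ j, ∏ k, (1 - X_k *
v j k)`. At a row `i` every factor is `0` or `1`, so `P(i)` counts the rows orthogonal to row `i`
(`eval_countPoly_natCast`). As `n < p`, this count vanishes modulo `p` only if it is zero. Moreover
`deg P ≤ (n - 1) * d < N` (`degree_countPoly_lt`), so `P` is determined by its values at `0, …, N -
1`. These values are the honest message.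

The verifier reads any message as values of a polynomial of degree less than `N` and compares that
polynomial with `P` at a random `t < 2 ^ w`, where `4 * N ≤ 2 ^ w < p`. Two distinct polynomials of
degree less than `N` agree at fewer than `N` points, so a message with a false value passes with
probability less than `1/4` (`truthful_of_accepts`). One evaluation of `P` takes `O(N)` field
operations, which suits the verifier; the prover needs `N` of them.

Truthful values reveal the first row with an orthogonal row, and a direct scan of the input finds
its first partner, so the output is the lexicographically first pair. The count includes the row
itself, but a row orthogonal to itself is zero and hence orthogonal to all rows, so on solvable
inputs this does no harm (`SearchResult.decodePair_eq`). Since the scan checks the inner product, a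
pair that is not a solution is never written; soundness on unsolvable inputs is perfect, and so is
completeness.

For the running time, Bertrand's postulate gives `p ≤ 2 * 2 ^ w < 16 * N`, so a sieve finds `p` in
`O(N log N)` steps. Inverses modulo `p` and Lagrange weights come from recurrences with a bounded
number of operations per entry. All stored numbers have `O(log N)` bits, so a step costs `O(log²
N)`. `Reaches` packages this as a total correctness judgement: it counts steps, bounds the bit
lengths and carries a postcondition, and the running times follow from `verifierCmd_reaches` and
`proverCmd_reaches`. -/

instance : Add Expr := ⟨.op .add⟩
instance : Sub Expr := ⟨.op .sub⟩
instance : Mul Expr := ⟨.op .mul⟩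
instance : Div Expr := ⟨.op .div⟩
instance : Mod Expr := ⟨.op .mod⟩

/-- The test `e₁ = e₂`. -/
def Expr.eq (e₁ e₂ : Expr) : Expr := .op .eq e₁ e₂

/-- The test `e₁ < e₂`. -/
def Expr.lt (e₁ e₂ : Expr) : Expr := .op .lt e₁ e₂

/-- The scalar variable kept in cell `0` of array `a`. -/
def Expr.var (a : ℕ) : Expr := .get a (.lit 0)

section eval
variable (m : ℕ → ℕ → ℕ) (e₁ e₂ : Expr)

@[simp] theorem Expr.eval_lit (k : ℕ) : (Expr.lit k).eval m = k := rfl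
@[simp] theorem Expr.eval_get (a : ℕ) : (Expr.get a e₁).eval m = m a (e₁.eval m) := rfl
@[simp] theorem Expr.eval_var (a : ℕ) : (Expr.var a).eval m = m a 0 := rfl
@[simp] theorem Expr.eval_add : (e₁ + e₂).eval m = e₁.eval m + e₂.eval m := rfl
@[simp] theorem Expr.eval_sub : (e₁ - e₂).eval m = e₁.eval m - e₂.eval m := rfl
@[simp] theorem Expr.eval_mul : (e₁ * e₂).eval m = e₁.eval m * e₂.eval m := rfl
@[simp] theorem Expr.eval_div : (e₁ / e₂).eval m = e₁.eval m / e₂.eval m := rfl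
@[simp] theorem Expr.eval_mod : (e₁ % e₂).eval m = e₁.eval m % e₂.eval m := rfl
@[simp] theorem Expr.eval_eq :
    (Expr.eq e₁ e₂).eval m = if e₁.eval m = e₂.eval m then 1 else 0 := rfl
@[simp] theorem Expr.eval_lt :
    (Expr.lt e₁ e₂).eval m = if e₁.eval m < e₂.eval m then 1 else 0 := rfl

end eval

/-- If all memory cells have at most `L` bits, then `e` has at most `e.width * (L + 1)` bits. -/
def Expr.width : Expr → ℕ
  | .lit k => k.size
  | .get _ _ => 1
  | .op _ e₁ e₂ => e₁.width + e₂.width + 1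

/-- If all memory cells have at most `L` bits, then `e` costs at most `e.weight * (L + 1) ^ 2`. -/
def Expr.weight : Expr → ℕ
  | .lit k => k.size + 1
  | .get _ i => i.weight + i.width + 2
  | .op _ e₁ e₂ => e₁.weight + e₂.weight + (e₁.width + 1) * (e₂.width + 1)

/-- All memory cells have at most `L` bits. -/
def Bounded (L : ℕ) (m : ℕ → ℕ → ℕ) : Prop := ∀ a i, m a i < 2 ^ L

/-- A product adds the two lengths and a sum gains at most one bit on the longer operand; the final
`+ 1` also covers the tests, which may return `1` on operands of length `0`. -/
theorem Op.size_eval_le (o : Op) (x y : ℕ) : (o.eval x y).size ≤ x.size + y.size + 1 := by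
  have hx := Nat.lt_size_self x
  have hy := Nat.lt_size_self y
  have h1 : x < 2 ^ (x.size + y.size) :=
    hx.trans_le (Nat.pow_le_pow_right two_pos (Nat.le_add_right _ _))
  have h2 : y < 2 ^ (x.size + y.size) :=
    hy.trans_le (Nat.pow_le_pow_right two_pos (Nat.le_add_left _ _))
  have h3 : 2 ^ (x.size + y.size + 1) = 2 ^ (x.size + y.size) + 2 ^ (x.size + y.size) := by
    rw [pow_succ]; ring
  have h4 : 1 ≤ 2 ^ (x.size + y.size) := Nat.one_le_two_pow
  rw [Nat.size_le]
  cases o with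
  | add => simp only [Op.eval]; omega
  | sub => simp only [Op.eval]; omega
  | mul =>
    have : x * y < 2 ^ x.size * 2 ^ y.size := Nat.mul_lt_mul'' hx hy
    rw [← pow_add] at this
    simp only [Op.eval]; omega
  | div => have := Nat.div_le_self x y; simp only [Op.eval]; omega
  | mod => have := Nat.mod_le x y; simp only [Op.eval]; omega
  | eq => simp only [Op.eval]; split_ifs <;> omega
  | lt => simp only [Op.eval]; split_ifs <;> omega

theorem Expr.size_eval_le {L : ℕ} {m : ℕ → ℕ → ℕ} (h : Bounded L m) (e : Expr) :
    (e.eval m).size ≤ e.width * (L + 1) := by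
  induction e with
  | lit k => exact Nat.le_mul_of_pos_right _ L.succ_pos
  | get a i _ =>
    have : (m a (i.eval m)).size ≤ L := Nat.size_le.2 (h _ _)
    simp only [Expr.eval, Expr.width]; omega
  | op o e₁ e₂ ih₁ ih₂ =>
    have := o.size_eval_le (e₁.eval m) (e₂.eval m)
    simp only [Expr.eval, Expr.width]
    linarith [Nat.zero_le L]

/-- The charge for an operation is a product of two lengths, each linear in `L + 1`; hence the
square, with a factor depending only on the syntax of the program. -/
theorem Expr.cost_le {L : ℕ} {m : ℕ → ℕ → ℕ} (h : Bounded L m) (e : Expr) :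
    e.cost m ≤ e.weight * (L + 1) ^ 2 := by
  have hZ : L + 1 ≤ (L + 1) ^ 2 := Nat.le_self_pow two_ne_zero _
  have hZ1 : 1 ≤ (L + 1) ^ 2 := Nat.one_le_pow _ _ L.succ_pos
  induction e with
  | lit k => exact Nat.le_mul_of_pos_right _ hZ1
  | get a i ih =>
    have h1 : (m a (i.eval m)).size ≤ L := Nat.size_le.2 (h _ _)
    have h2 := i.size_eval_le h
    have h3 : i.width * (L + 1) ≤ i.width * (L + 1) ^ 2 := Nat.mul_le_mul_left _ hZ
    simp only [Expr.cost, Expr.weight, add_mul]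
    omega
  | op o e₁ e₂ ih₁ ih₂ =>
    have h1 := e₁.size_eval_le h
    have h2 := e₂.size_eval_le h
    have h3 : ((e₁.eval m).size + 1) * ((e₂.eval m).size + 1)
        ≤ ((e₁.width + 1) * (L + 1)) * ((e₂.width + 1) * (L + 1)) := by
      apply Nat.mul_le_mul <;> rw [add_mul] <;> omega
    have h4 : ((e₁.width + 1) * (L + 1)) * ((e₂.width + 1) * (L + 1))
        = (e₁.width + 1) * (e₂.width + 1) * (L + 1) ^ 2 := by ring
    simp only [Expr.cost, Expr.weight, add_mul _ _ ((L + 1) ^ 2)]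
    omega

/-! ## Frame conditions -/

/-- The arrays that a command may modify. -/
def Cmd.writes : Cmd → List ℕ
  | .skip => []
  | .set a _ _ => [a]
  | .flip a _ => [a]
  | .write _ => []
  | .seq c₁ c₂ => c₁.writes ++ c₂.writes
  | .ite _ c₁ c₂ => c₁.writes ++ c₂.writes
  | .while _ c => c.writes

/-- The command tosses no coins. -/
def Cmd.flipFree : Cmd → Bool
  | .skip | .set _ _ _ | .write _ => true
  | .flip _ _ => false
  | .seq c₁ c₂ => c₁.flipFree && c₂.flipFree
  | .ite _ c₁ c₂ => c₁.flipFree && c₂.flipFree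
  | .while _ c => c.flipFree

/-- The command does not use the output tape. -/
def Cmd.writeFree : Cmd → Bool
  | .skip | .set _ _ _ | .flip _ _ => true
  | .write _ => false
  | .seq c₁ c₂ => c₁.writeFree && c₂.writeFree
  | .ite _ c₁ c₂ => c₁.writeFree && c₂.writeFree
  | .while _ c => c.writeFree

/-- The states `s` and `s'` differ only in what the command `c` may modify. -/
structure Frame (c : Cmd) (s s' : State) : Prop where
  mem : ∀ a, a ∉ c.writes → s'.mem a = s.mem a
  pos : c.flipFree → s'.pos = s.pos
  out : c.writeFree → s'.out = s.out

theorem Frame.refl (c : Cmd) (s : State) : Frame c s s := ⟨fun _ _ => rfl, fun _ => rfl, fun _ => rfl⟩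

theorem Frame.trans {c : Cmd} {s₁ s₂ s₃ : State} (h : Frame c s₁ s₂) (h' : Frame c s₂ s₃) :
    Frame c s₁ s₃ :=
  ⟨fun a ha => (h'.mem a ha).trans (h.mem a ha), fun hc => (h'.pos hc).trans (h.pos hc),
    fun hc => (h'.out hc).trans (h.out hc)⟩

theorem Frame.mono {c c' : Cmd} {s s' : State} (h : Frame c s s')
    (hw : ∀ a ∈ c.writes, a ∈ c'.writes) (hf : c'.flipFree → c.flipFree)
    (ho : c'.writeFree → c.writeFree) : Frame c' s s' :=
  ⟨fun a ha => h.mem a fun h' => ha (hw a h'), fun hc => h.pos (hf hc), fun hc => h.out (ho hc)⟩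

@[simp] theorem State.store_mem_same (s : State) (a i x : ℕ) :
    (s.store a i x).mem a = Function.update (s.mem a) i x := by
  simp [State.store]

theorem State.store_mem_of_ne (s : State) {a b : ℕ} (i x : ℕ) (h : b ≠ a) :
    (s.store a i x).mem b = s.mem b := by
  simp [State.store, Function.update_of_ne h]

@[simp] theorem State.store_mem (s : State) (a b i x : ℕ) :
    (s.store a i x).mem b = if b = a then Function.update (s.mem a) i x else s.mem b := by
  split_ifs with h
  · subst h; simp
  · exact s.store_mem_of_ne i x h

@[simp] theorem State.store_pos (s : State) (a i x : ℕ) : (s.store a i x).pos = s.pos := rfl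
@[simp] theorem State.store_out (s : State) (a i x : ℕ) : (s.store a i x).out = s.out := rfl

/-- Membership in `writes` is decidable for a concrete program, so `decide` settles that an array is
unchanged. Loop invariants therefore only mention cells that the loop modifies. -/
theorem Exec.frame {ω : ℕ → Bool} {c : Cmd} {s s' : State} {t : ℕ} (h : Exec ω c s s' t) :
    Frame c s s' := by
  induction h with
  | skip | while_false => exact Frame.refl _ _
  | set a i e s =>
    exact ⟨fun b hb => s.store_mem_of_ne _ _ (by simpa [Cmd.writes] using hb),
      fun _ => rfl, fun _ => rfl⟩
  | flip a i s =>
    exact ⟨fun b hb => s.store_mem_of_ne _ _ (by simpa [Cmd.writes] using hb),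
      fun h => by simp [Cmd.flipFree] at h, fun _ => rfl⟩
  | write e s => exact ⟨fun _ _ => rfl, fun _ => rfl, fun h => by simp [Cmd.writeFree] at h⟩
  | seq _ _ ih₁ ih₂ =>
    exact (ih₁.mono (by simp +contextual [Cmd.writes]) (by simp +contextual [Cmd.flipFree])
      (by simp +contextual [Cmd.writeFree])).trans (ih₂.mono (by simp +contextual [Cmd.writes])
      (by simp +contextual [Cmd.flipFree]) (by simp +contextual [Cmd.writeFree]))
  | ite_true _ _ ih | ite_false _ _ ih =>
    exact ih.mono (by simp +contextual [Cmd.writes]) (by simp +contextual [Cmd.flipFree])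
      (by simp +contextual [Cmd.writeFree])
  | while_true _ _ _ ih₁ ih₂ =>
    exact (ih₁.mono (by simp [Cmd.writes]) (by simp [Cmd.flipFree])
      (by simp [Cmd.writeFree])).trans ih₂

/-! ## Total correctness with step counts -/

/-- The cost of one step of the command, in units of `(L + 1) ^ 2`. -/
def Cmd.weight : Cmd → ℕ
  | .skip => 1
  | .set _ i e => i.weight + e.weight + i.width + e.width + 1
  | .flip _ i => i.weight + i.width + 2
  | .write e => e.weight + e.width + 1
  | .seq c₁ c₂ => c₁.weight + c₂.weight
  | .ite e c₁ c₂ => e.weight + c₁.weight + c₂.weight + 1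
  | .while e c => e.weight + c.weight + 1

/-- Started in `s`, the command halts after at most `k` steps in a state that satisfies `Q`, and
all stored numbers have at most `L` bits. -/
def Reaches (ω : ℕ → Bool) (L : ℕ) (c : Cmd) (s : State) (k : ℕ) (Q : State → Prop) : Prop :=
  Bounded L s.mem → ∃ s' t, Exec ω c s s' t ∧ t ≤ c.weight * (L + 1) ^ 2 * k ∧
    Bounded L s'.mem ∧ Q s'

theorem Bounded.store {L : ℕ} {s : State} (h : Bounded L s.mem) {a i x : ℕ} (hx : x < 2 ^ L) :
    Bounded L (s.store a i x).mem := by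
  intro b j
  rw [State.store_mem]
  split_ifs with hb
  · rw [Function.update_apply]
    split_ifs
    · exact hx
    · exact h _ _
  · exact h _ _

namespace Reaches

variable {ω : ℕ → Bool} {L : ℕ} {s : State} {Q Q' : State → Prop} {k k' k₁ k₂ : ℕ}
  {c c₁ c₂ : Cmd} {e : Expr}

/-- The new postcondition may use the frame of the run, which is how facts about untouched arrays
pass from one phase to the next. -/
theorem mono (h : Reaches ω L c s k Q) (hk : k ≤ k') (hQ : ∀ s', Frame c s s' → Q s' → Q' s') :
    Reaches ω L c s k' Q' := by
  intro hb
  obtain ⟨s', t, he, ht, hb', hs'⟩ := h hb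
  exact ⟨s', t, he, ht.trans (Nat.mul_le_mul_left _ hk), hb', hQ s' he.frame hs'⟩

/-- Gives access to the bit bound at an intermediate state, for assignments whose value is small
only because the cells are. -/
theorem bounded (h : Bounded L s.mem → Reaches ω L c s k Q) : Reaches ω L c s k Q :=
  fun hb => h hb hb

theorem skip (h : Q s) : Reaches ω L .skip s 1 Q := fun hb =>
  ⟨s, 1, .skip s, by simpa [Cmd.weight] using Nat.one_le_pow _ _ L.succ_pos, hb, h⟩

theorem set {a : ℕ} {i e : Expr} (he : e.eval s.mem < 2 ^ L)
    (h : Q (s.store a (i.eval s.mem) (e.eval s.mem))) : Reaches ω L (.set a i e) s 1 Q := by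
  intro hb
  refine ⟨_, _, .set a i e s, ?_, hb.store he, h⟩
  have h1 := i.cost_le hb
  have h2 := e.cost_le hb
  have h3 := i.size_eval_le hb
  have h4 := e.size_eval_le hb
  have hZ : L + 1 ≤ (L + 1) ^ 2 := Nat.le_self_pow two_ne_zero _
  have h5 := Nat.mul_le_mul_left i.width hZ
  have h6 := Nat.mul_le_mul_left e.width hZ
  simp only [Cmd.weight, add_mul _ _ ((L + 1) ^ 2), mul_one]
  omega

theorem flip {a : ℕ} {i : Expr} (hL : 0 < L)
    (h : Q { s.store a (i.eval s.mem) (ω s.pos).toNat with pos := s.pos + 1 }) :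
    Reaches ω L (.flip a i) s 1 Q := by
  intro hb
  refine ⟨_, _, .flip a i s, ?_, hb.store (x := (ω s.pos).toNat) ?_, h⟩
  · have h1 := i.cost_le hb
    have h3 := i.size_eval_le hb
    have hZ : L + 1 ≤ (L + 1) ^ 2 := Nat.le_self_pow two_ne_zero _
    have h5 := Nat.mul_le_mul_left i.width hZ
    simp only [Cmd.weight, add_mul _ _ ((L + 1) ^ 2), mul_one]
    omega
  · exact (Bool.toNat_le _).trans_lt (Nat.one_lt_two_pow hL.ne')

theorem write (h : Q { s with out := s.out ++ [e.eval s.mem] }) :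
    Reaches ω L (.write e) s 1 Q := by
  intro hb
  refine ⟨_, _, .write e s, ?_, hb, h⟩
  have h2 := e.cost_le hb
  have h4 := e.size_eval_le hb
  have hZ : L + 1 ≤ (L + 1) ^ 2 := Nat.le_self_pow two_ne_zero _
  have h6 := Nat.mul_le_mul_left e.width hZ
  simp only [Cmd.weight, add_mul _ _ ((L + 1) ^ 2), mul_one]
  omega

/-- Weights and step counts both add, so the product bound contains surplus cross terms. This waste
is only a factor depending on the program. -/
theorem seq (h : Reaches ω L c₁ s k₁ fun s' => Reaches ω L c₂ s' k₂ Q) :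
    Reaches ω L (.seq c₁ c₂) s (k₁ + k₂) Q := by
  intro hb
  obtain ⟨s', t, he, ht, hb', hs'⟩ := h hb
  obtain ⟨s'', t', he', ht', hb'', hs''⟩ := hs' hb'
  refine ⟨s'', _, he.seq he', ?_, hb'', hs''⟩
  simp only [Cmd.weight]
  nlinarith [Nat.zero_le (c₁.weight * (L + 1) ^ 2 * k₂), Nat.zero_le (c₂.weight * (L + 1) ^ 2 * k₁)]

theorem ite (ht : e.eval s.mem ≠ 0 → Reaches ω L c₁ s k Q)
    (hf : e.eval s.mem = 0 → Reaches ω L c₂ s k Q) :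
    Reaches ω L (.ite e c₁ c₂) s (k + 1) Q := by
  intro hb
  have h2 := e.cost_le hb
  have hZ : 1 ≤ (L + 1) ^ 2 := Nat.one_le_pow _ _ L.succ_pos
  by_cases he : e.eval s.mem = 0
  · obtain ⟨s', t, hx, ht, hb', hs'⟩ := hf he hb
    refine ⟨s', _, .ite_false he hx, ?_, hb', hs'⟩
    simp only [Cmd.weight]
    nlinarith [Nat.zero_le ((e.weight + c₁.weight + 1) * (L + 1) ^ 2 * k),
      Nat.zero_le ((c₁.weight + c₂.weight) * (L + 1) ^ 2)]
  · obtain ⟨s', t, hx, ht, hb', hs'⟩ := ht he hb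
    refine ⟨s', _, .ite_true he hx, ?_, hb', hs'⟩
    simp only [Cmd.weight]
    nlinarith [Nat.zero_le ((e.weight + c₂.weight + 1) * (L + 1) ^ 2 * k),
      Nat.zero_le ((c₁.weight + c₂.weight) * (L + 1) ^ 2)]

theorem while_false (he : e.eval s.mem = 0) (h : Q s) : Reaches ω L (.while e c) s 1 Q := by
  intro hb
  refine ⟨s, _, .while_false he, ?_, hb, h⟩
  have h2 := e.cost_le hb
  have hZ : 1 ≤ (L + 1) ^ 2 := Nat.one_le_pow _ _ L.succ_pos
  simp only [Cmd.weight]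
  nlinarith [Nat.zero_le (c.weight * (L + 1) ^ 2)]

theorem while_true (he : e.eval s.mem ≠ 0)
    (h : Reaches ω L c s k₁ fun s' => Reaches ω L (.while e c) s' k₂ Q) :
    Reaches ω L (.while e c) s (k₁ + k₂ + 1) Q := by
  intro hb
  obtain ⟨s', t, hx, ht, hb', hs'⟩ := h hb
  obtain ⟨s'', t', hx', ht', hb'', hs''⟩ := hs' hb'
  refine ⟨s'', _, .while_true he hx hx', ?_, hb'', hs''⟩
  have h2 := e.cost_le hb
  have hZ : 1 ≤ (L + 1) ^ 2 := Nat.one_le_pow _ _ L.succ_pos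
  simp only [Cmd.weight] at ht' ⊢
  nlinarith [Nat.zero_le ((e.weight + 1) * (L + 1) ^ 2 * k₁), Nat.zero_le (c.weight * (L + 1) ^ 2)]

end Reaches

/-! ### Counting loops. -/

/-- Assignment to a scalar variable. -/
def Cmd.assign (a : ℕ) (e : Expr) : Cmd := .set a (.lit 0) e

/-- `for v = 0, …, e - 1 do c`. -/
def Cmd.for (v : ℕ) (e : Expr) (c : Cmd) : Cmd :=
  .seq (.assign v (.lit 0))
    (.while (.lt (.var v) e) (.seq c (.assign v (.var v + .lit 1))))

namespace Reaches

variable {ω : ℕ → Bool} {L : ℕ} {s : State} {Q : State → Prop} {c : Cmd} {e : Expr}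

theorem assign {a : ℕ} (he : e.eval s.mem < 2 ^ L) (h : Q (s.store a 0 (e.eval s.mem))) :
    Reaches ω L (.assign a e) s 1 Q :=
  Reaches.set he h

/-- The rule for loops: `I k` is an invariant for the moment before the `k`-th round. -/
theorem for_loop {v N : ℕ} (I : ℕ → State → Prop) (T : ℕ → ℕ)
    (hv : v ∉ c.writes) (hN : N < 2 ^ L)
    (he : ∀ s', Frame (.for v e c) s s' → e.eval s'.mem = N)
    (h0 : I 0 (s.store v 0 0))
    (hstep : ∀ k s', k < N → Frame (.for v e c) s s' → s'.mem v 0 = k → I k s' →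
      Reaches ω L c s' (T k) fun s'' => I (k + 1) (s''.store v 0 (k + 1)))
    (hQ : ∀ s', Frame (.for v e c) s s' → I N s' → Q s') :
    Reaches ω L (.for v e c) s (∑ k ∈ Finset.range N, (T k + 2) + 2) Q := by
  have hstore : ∀ s' x, Frame (.for v e c) s s' → Frame (.for v e c) s (s'.store v 0 x) :=
    fun s' x hs' => hs'.trans ⟨fun a ha => State.store_mem_of_ne _ _ _ (by
      rintro rfl; exact ha (by simp [Cmd.for, Cmd.assign, Cmd.writes])), fun _ => rfl, fun _ => rfl⟩
  -- Induction on the number `j` of rounds that remain, for all states at which round `k = N - j` is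
  -- about to start.
  have key : ∀ j k s', k + j = N → Frame (.for v e c) s s' → s'.mem v 0 = k → I k s' →
      Reaches ω L (.while (.lt (.var v) e) (.seq c (.assign v (.var v + .lit 1)))) s'
        (∑ i ∈ Finset.range j, (T (k + i) + 2) + 1) Q := by
    intro j
    induction j with
    | zero =>
      intro k s' hk hf hv hI
      refine (Reaches.while_false ?_ (hQ s' hf ?_)).mono (by simp) fun _ _ h => h
      · simp [he s' hf, hv]; omega
      · rwa [← show k = N by omega]
    | succ j ih =>
      intro k s' hk hf hvk hI
      refine (Reaches.while_true (k₁ := T k + 1)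
        (k₂ := ∑ i ∈ Finset.range j, (T (k + 1 + i) + 2) + 1) ?_ (Reaches.seq
        ((hstep k s' (by omega) hf hvk hI).mono le_rfl ?_))).mono ?_ fun _ _ h => h
      · simp [he s' hf, hvk]; omega
      · intro s'' hf' hI'
        have hvk' : s''.mem v 0 = k := by rw [hf'.mem v hv, hvk]
        have hf'' : Frame (.for v e c) s s'' := hf.trans (hf'.mono
          (by simp +contextual [Cmd.for, Cmd.assign, Cmd.writes])
          (by simp +contextual [Cmd.for, Cmd.assign, Cmd.flipFree])
          (by simp +contextual [Cmd.for, Cmd.assign, Cmd.writeFree]))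
        refine Reaches.assign ?_ (ih (k + 1) _ (by omega) (hstore _ _ hf'') ?_ ?_)
        · simp [hvk']; omega
        · simp [hvk']
        · simpa [hvk'] using hI'
      · rw [Finset.sum_range_succ']
        have : ∑ i ∈ Finset.range j, (T (k + (i + 1)) + 2) =
            ∑ i ∈ Finset.range j, (T (k + 1 + i) + 2) :=
          Finset.sum_congr rfl fun i _ => by rw [show k + (i + 1) = k + 1 + i by omega]
        rw [add_zero]
        omega
  refine (Reaches.seq (k₁ := 1)
    (k₂ := ∑ i ∈ Finset.range N, (T (0 + i) + 2) + 1) (Reaches.assign (by simp) ?_)).mono ?_ fun _ _ h => h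
  · exact key N 0 _ (by simp) (hstore _ _ (Frame.refl _ _)) (by simp) h0
  · simp only [zero_add]; omega

/-- The rule for loops whose rounds take the same time. -/
theorem for_loop_const {v N : ℕ} (I : ℕ → State → Prop) (T : ℕ)
    (hv : v ∉ c.writes) (hN : N < 2 ^ L)
    (he : ∀ s', Frame (.for v e c) s s' → e.eval s'.mem = N)
    (h0 : I 0 (s.store v 0 0))
    (hstep : ∀ k s', k < N → Frame (.for v e c) s s' → s'.mem v 0 = k → I k s' →
      Reaches ω L c s' T fun s'' => I (k + 1) (s''.store v 0 (k + 1)))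
    (hQ : ∀ s', Frame (.for v e c) s s' → I N s' → Q s') :
    Reaches ω L (.for v e c) s (N * (T + 2) + 2) Q :=
  (for_loop I (fun _ => T) hv hN he h0 hstep hQ).mono (by simp) fun _ _ h => h

end Reaches

infixr:60 " ;; " => Cmd.seq

/-! ## Common parameters: a power of two, a prime, and a table of inverses -/

/-- The least prime above `M`. -/
noncomputable def primeAbove (M : ℕ) : ℕ := sInf {p | p.Prime ∧ M < p}

theorem primeAbove_spec (M : ℕ) : (primeAbove M).Prime ∧ M < primeAbove M := by
  obtain ⟨p, hp, hp'⟩ := Nat.exists_infinite_primes (M + 1)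
  exact Nat.sInf_mem (s := {p | p.Prime ∧ M < p}) ⟨p, hp', hp⟩

theorem primeAbove_le {M p : ℕ} (hp : p.Prime) (h : M < p) : primeAbove M ≤ p :=
  Nat.sInf_le (s := {p | p.Prime ∧ M < p}) ⟨hp, h⟩

theorem primeAbove_le_two_mul {M : ℕ} (hM : M ≠ 0) : primeAbove M ≤ 2 * M := by
  obtain ⟨p, hp, h1, h2⟩ := Nat.exists_prime_lt_and_le_two_mul M hM
  exact (primeAbove_le hp h1).trans h2

/-- Compute `N = n * d` (in array `2`), the least `w` with `4 * N ≤ 2 ^ w` (in array `4`),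
and `M = 2 ^ w` (in array `3`). -/
def sizesCmd : Cmd :=
  .assign 2 (.get 0 (.lit 0) * .get 0 (.lit 1)) ;;
  .assign 3 (.lit 1) ;;
  .assign 4 (.lit 0) ;;
  .for 8 (.lit 4 * .var 2)
    (.ite (.lt (.var 3) (.lit 4 * .var 2))
      (.assign 3 (.lit 2 * .var 3) ;; .assign 4 (.var 4 + .lit 1)) .skip)

/-- The loop makes `4 * N` rounds, more than are needed, and stops doubling once the target is
reached. Hence after `k` rounds the exponent is `min k` of its final value. -/
theorem sizesCmd_reaches {ω : ℕ → Bool} {L : ℕ} {s : State} {n d : ℕ} (hn : s.mem 0 0 = n)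
    (hd : s.mem 0 1 = d) (hL : 32 * (n * d) + 32 ≤ 2 ^ L) :
    Reaches ω L sizesCmd s (20 * (n * d) + 5) fun s' =>
      s'.mem 2 0 = n * d ∧ s'.mem 4 0 = Nat.clog 2 (4 * (n * d)) ∧
        s'.mem 3 0 = 2 ^ Nat.clog 2 (4 * (n * d)) := by
  have main : Reaches ω L sizesCmd s (1 + (1 + (1 + (4 * (n * d) * (3 + 2) + 2)))) fun s' =>
      s'.mem 2 0 = n * d ∧ s'.mem 4 0 = Nat.clog 2 (4 * (n * d)) ∧
        s'.mem 3 0 = 2 ^ Nat.clog 2 (4 * (n * d)) := by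
    refine Reaches.seq (Reaches.assign ?_ ?_)
    · simp [hn, hd]; omega
    refine Reaches.seq (Reaches.assign ?_ ?_)
    · simp only [Expr.eval_lit]; omega
    refine Reaches.seq (Reaches.assign ?_ ?_)
    · simp
    refine Reaches.for_loop_const (N := 4 * (n * d)) (fun k s' =>
      s'.mem 4 0 = min k (Nat.clog 2 (4 * (n * d))) ∧
        s'.mem 3 0 = 2 ^ min k (Nat.clog 2 (4 * (n * d)))) 3 (by decide) (by omega) ?_ ?_ ?_ ?_
    · intro s' h
      simp [h.mem 2 (by decide), hn, hd]
    · simp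
    · rintro k s' hk h hv ⟨h4, h3⟩
      have h2 : s'.mem 2 0 = n * d := by simp [h.mem 2 (by decide), hn, hd]
      refine Reaches.ite (k := 2) ?_ ?_
      · intro he
        have he : 2 ^ min k (Nat.clog 2 (4 * (n * d))) < 4 * (n * d) := by
          simpa [h2, h3] using he
        have hk' : k < Nat.clog 2 (4 * (n * d)) := by
          by_contra hc
          rw [min_eq_right (not_lt.1 hc)] at he
          exact absurd (Nat.le_pow_clog one_lt_two _) (not_le.2 he)
        rw [min_eq_left hk'.le] at h4 h3 he
        refine Reaches.seq (k₁ := 1) (k₂ := 1) (Reaches.assign ?_ (Reaches.assign ?_ ?_))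
        · simp [h3]; omega
        · have := hk'.trans_le (Nat.clog_le_of_le_pow (b := 2) (Nat.lt_two_pow_self (n := 4 * (n * d))).le)
          simp [h4]; omega
        · have := min_eq_left (Nat.succ_le_of_lt hk')
          simp only [Nat.succ_eq_add_one] at this
          simp [h3, h4, this, pow_succ']
      · intro he
        have he : 4 * (n * d) ≤ 2 ^ min k (Nat.clog 2 (4 * (n * d))) := by
          simpa [h2, h3] using he
        have hk' : Nat.clog 2 (4 * (n * d)) ≤ k :=
          (Nat.clog_le_of_le_pow he).trans (min_le_left _ _)
        refine (Reaches.skip ?_).mono (by simp) fun _ _ h => h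
        simp [h3, h4, min_eq_right hk', min_eq_right (hk'.trans k.le_succ)]
    · rintro s' h ⟨h4, h3⟩
      have : Nat.clog 2 (4 * (n * d)) ≤ 4 * (n * d) :=
        Nat.clog_le_of_le_pow (Nat.lt_two_pow_self).le
      rw [min_eq_right this] at h3 h4
      exact ⟨by simp [h.mem 2 (by decide), hn, hd], h4, h3⟩
  exact main.mono (by omega) fun _ _ h => h

/-! ### The sieve of Eratosthenes. -/

/-- Mark the composite numbers up to `2 * M` in array `5`. -/
def sieveCmd : Cmd :=
  .for 8 (.lit 2 * .var 3)
    (.for 9 (.lit 2 * .var 3 / (.var 8 + .lit 2))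
      (.set 5 ((.var 8 + .lit 2) * (.var 9 + .lit 2)) (.lit 1)))

/-- A harmonic sum, bounded by dyadic blocks: the upper half of the range contributes at most `N`,
and halving can be repeated only logarithmically often. -/
theorem sum_div_le (B N : ℕ) : ∑ q ∈ Finset.range B, N / (q + 2) ≤ N * Nat.log 2 (B + 1) := by
  induction B using Nat.strong_induction_on with
  | _ B ih =>
    rcases Nat.lt_or_ge B 1 with hB | hB
    · simp [show B = 0 by omega]
    -- With this `b`, at most `b + 2` terms remain, each at most `N / (b + 2)`; and `2 * (b + 1) ≤ B
    -- + 1`, so the logarithm drops by one.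
    · obtain ⟨b, hb, hb'⟩ : ∃ b, b < B ∧ (B = 2 * b + 1 ∨ B = 2 * b + 2) :=
        ⟨(B - 1) / 2, by omega, by omega⟩
      have h1 : ∑ q ∈ Finset.range B, N / (q + 2) ≤
          ∑ q ∈ Finset.range b, N / (q + 2) + N := by
        have h2 : ∑ q ∈ Finset.Ico b B, N / (q + 2) ≤ (B - b) * (N / (b + 2)) := by
          rw [← Nat.card_Ico, ← smul_eq_mul]
          refine Finset.sum_le_card_nsmul _ _ _ fun q hq => ?_
          exact Nat.div_le_div_left (by have := (Finset.mem_Ico.1 hq).1; omega) (by omega)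
        have h3 : (B - b) * (N / (b + 2)) ≤ N :=
          (Nat.mul_le_mul_right _ (by omega)).trans (Nat.mul_div_le N (b + 2))
        rw [← Finset.sum_range_add_sum_Ico _ hb.le]
        omega
      have h4 : Nat.log 2 (b + 1) + 1 ≤ Nat.log 2 (B + 1) := by
        rw [← Nat.log_mul_base one_lt_two (by omega)]
        exact Nat.log_mono_right (by omega)
      calc _ ≤ _ := h1
        _ ≤ N * Nat.log 2 (b + 1) + N := by have := ih b hb; omega
        _ = N * (Nat.log 2 (b + 1) + 1) := by ring
        _ ≤ _ := Nat.mul_le_mul_left _ h4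

/-- The invariant has two halves: every marked number is composite, and all proper multiples in
range of the divisors `q + 2` treated so far are marked. The inner loops together take a harmonic
sum of steps. -/
theorem sieveCmd_reaches {ω : ℕ → Bool} {L : ℕ} {s : State} {M : ℕ} (hM : s.mem 3 0 = M)
    (h0 : ∀ c, s.mem 5 c = 0) (hL : 2 * M + 2 ≤ 2 ^ L) :
    Reaches ω L sieveCmd s (6 * M * (Nat.log 2 (2 * M + 1) + 2) + 2) fun s' =>
      ∀ c, 2 ≤ c → c ≤ 2 * M → (s'.mem 5 c = 0 ↔ c.Prime) := by
  have main : Reaches ω L sieveCmd s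
      (∑ q ∈ Finset.range (2 * M), (2 * M / (q + 2) * (1 + 2) + 2 + 2) + 2) fun s' =>
      ∀ c, 2 ≤ c → c ≤ 2 * M → (s'.mem 5 c = 0 ↔ c.Prime) := by
    refine Reaches.for_loop (fun k s' => (∀ c, s'.mem 5 c ≠ 0 → ¬ c.Prime) ∧
      ∀ q < k, ∀ j < 2 * M / (q + 2), s'.mem 5 ((q + 2) * (j + 2)) ≠ 0)
      (fun q => 2 * M / (q + 2) * (1 + 2) + 2) (by decide) (by omega) ?_ ?_ ?_ ?_
    · intro s' h
      simp [h.mem 3 (by decide), hM]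
    · simp [h0]
    · rintro k s' hk h hv ⟨hI, hI'⟩
      have h3 : s'.mem 3 0 = M := by rw [h.mem 3 (by decide), hM]
      refine Reaches.for_loop_const (N := 2 * M / (k + 2)) (fun i s'' =>
        (∀ c, s''.mem 5 c ≠ 0 → ¬ c.Prime) ∧
        (∀ q < k, ∀ j < 2 * M / (q + 2), s''.mem 5 ((q + 2) * (j + 2)) ≠ 0) ∧
        ∀ j < i, s''.mem 5 ((k + 2) * (j + 2)) ≠ 0) 1 (by decide)
        (by have := Nat.div_le_self (2 * M) (k + 2); omega) ?_ ?_ ?_ ?_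
      · intro s'' h'
        simp [h'.mem 3 (by decide), h3, h'.mem 8 (by decide), hv]
      · simpa using ⟨hI, hI'⟩
      · rintro i s'' hi h' hv' ⟨hJ1, hJ2, hJ3⟩
        refine Reaches.set ?_ ?_
        · simp only [Expr.eval_lit]; omega
        · have h8 : s''.mem 8 0 = k := by rw [h'.mem 8 (by decide), hv]
          simp only [State.store_mem, Expr.eval_mul, Expr.eval_add, Expr.eval_var, Expr.eval_lit,
            h8, hv']
          simp only [Nat.reduceEqDiff, if_true, if_false, Function.update_apply]
          refine ⟨fun c => ?_, fun q hq j hj => ?_, fun j hj => ?_⟩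
          · split_ifs with hc
            · rintro - hp
              rw [hc] at hp
              exact Nat.not_prime_mul (by omega) (by omega) hp
            · exact hJ1 c
          · split_ifs
            · simp
            · exact hJ2 q hq j hj
          · split_ifs with hc
            · simp
            · refine hJ3 j (lt_of_le_of_ne (Nat.lt_succ_iff.1 hj) ?_)
              rintro rfl
              exact hc rfl
      · rintro s'' h' ⟨hJ1, hJ2, hJ3⟩
        simp only [State.store_mem, Nat.reduceEqDiff, if_false]
        refine ⟨hJ1, fun q hq j hj => ?_⟩
        rcases Nat.lt_succ_iff_lt_or_eq.1 hq with hq | rfl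
        · exact hJ2 q hq j hj
        · exact hJ3 j hj
    · rintro s' h ⟨hI, hI'⟩ c hc hc'
      refine ⟨fun h5 => ?_, fun hp => by_contra fun h5 => hI c h5 hp⟩
      by_contra hp
      -- An unmarked composite `a * b` would have been marked in outer round `a - 2` and inner round
      -- `b - 2`.
      obtain ⟨a, b, ha, hb, rfl⟩ := (Nat.not_prime_iff_exists_mul_eq hc).1 hp
      have hb2 : 2 ≤ b := by by_contra hb2; interval_cases b <;> omega
      have ha2 : 2 ≤ a := by by_contra ha2; interval_cases a <;> omega
      obtain ⟨a, rfl⟩ := Nat.exists_eq_add_of_le' ha2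
      obtain ⟨b, rfl⟩ := Nat.exists_eq_add_of_le' hb2
      refine hI' a (by omega) b ?_ h5
      have := (Nat.le_div_iff_mul_le (by omega)).2 ((mul_comm _ _).trans_le hc')
      omega
  refine main.mono ?_ fun _ _ h => h
  have := sum_div_le (2 * M) (2 * M)
  simp only [Finset.sum_add_distrib, ← Finset.sum_mul]
  simp only [Finset.sum_const, Finset.card_range, smul_eq_mul]
  nlinarith

/-- Search for the least prime above `M`, and store it in array `6`. -/
def primeCmd : Cmd :=
  .assign 6 (.lit 0) ;;
  .for 8 (.lit 2 * .var 3 + .lit 1)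
    (.ite (.var 6) .skip
      (.ite (.lt (.var 3) (.var 8)) (.ite (.get 5 (.var 8)) .skip (.assign 6 (.var 8))) .skip))

/-- Content `0` means that no prime has been found yet, which is unambiguous because primes are
nonzero. Bertrand's postulate makes the search range `2 * M` sufficient. -/
theorem primeCmd_reaches {ω : ℕ → Bool} {L : ℕ} {s : State} {M : ℕ} (hM : s.mem 3 0 = M)
    (hM0 : 2 ≤ M)
    (h5 : ∀ c, 2 ≤ c → c ≤ 2 * M → (s.mem 5 c = 0 ↔ c.Prime)) (hL : 2 * M + 2 ≤ 2 ^ L) :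
    Reaches ω L primeCmd s (12 * M + 9) fun s' => s'.mem 6 0 = primeAbove M := by
  have main : Reaches ω L primeCmd s (1 + ((2 * M + 1) * (4 + 2) + 2)) fun s' =>
      s'.mem 6 0 = primeAbove M := by
    refine Reaches.seq (Reaches.assign (by simp) ?_)
    refine Reaches.for_loop_const (N := 2 * M + 1)
      (fun k s' => s'.mem 6 0 = if primeAbove M < k then primeAbove M else 0) 4 (by decide)
      (by omega) ?_ ?_ ?_ ?_
    · intro s' h
      simp [h.mem 3 (by decide), hM]
    · simp
    · intro k s' hk h hv hI
      have h3 : s'.mem 3 0 = M := by rw [h.mem 3 (by decide)]; simp [hM]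
      have h5' : s'.mem 5 = s.mem 5 := by rw [h.mem 5 (by decide)]; simp
      obtain ⟨hp, hp'⟩ := primeAbove_spec M
      refine Reaches.ite (k := 3) ?_ ?_
      · intro he
        refine (Reaches.skip ?_).mono (by simp) fun _ _ h => h
        simp only [Expr.eval_var] at he
        have : primeAbove M < k := by by_contra hc; simp [hI, hc] at he
        simp [hI, this, this.trans k.lt_succ_self]
      · intro he
        have hlt : ¬ primeAbove M < k := by
          intro hc; simp [hI, hc] at he; omega
        rw [if_neg hlt] at hI
        refine Reaches.ite (k := 2) ?_ ?_
        · intro he'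
          have he' : M < k := by simpa [h3, hv] using he'
          refine Reaches.ite (k := 1) ?_ ?_
          · intro he''
            have he'' : ¬ k.Prime := by
              rwa [← h5 k (by omega) (by omega), ← h5', ← hv]
            have : primeAbove M ≠ k := by rintro rfl; exact he'' hp
            refine Reaches.skip ?_
            simp [hI]; omega
          · intro he''
            have he'' : k.Prime := by
              rwa [← h5 k (by omega) (by omega), ← h5', ← hv]
            have : primeAbove M = k := le_antisymm (primeAbove_le he'' he') (not_lt.1 hlt)
            refine Reaches.assign ?_ ?_
            · simp [hv]; omega
            · simp [hv, this]
        · intro he'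
          have he' : k ≤ M := by simpa [h3, hv] using he'
          refine (Reaches.skip ?_).mono (by simp) fun _ _ h => h
          simp [hI]; omega
    · intro s' h hI
      rw [hI, if_pos]
      have := primeAbove_le_two_mul (M := M) (by omega)
      omega
  exact main.mono (by omega) fun _ _ h => h

/-- Tabulate the inverses modulo the prime `p` of array `6` in array `7`. -/
def inverseCmd : Cmd :=
  .for 8 (.var 6)
    (.ite (.lt (.var 8) (.lit 2)) (.set 7 (.var 8) (.lit 1))
      (.set 7 (.var 8) ((.var 6 - .var 6 / .var 8) * .get 7 (.var 6 % .var 8) % .var 6)))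

/-- Read `p = (p / i) * i + p % i` modulo `p` and divide by `i * (p % i)`. This expresses the
inverse of `i` by that of the smaller number `p % i`. -/
theorem ZMod.inv_natCast_eq {p i : ℕ} [Fact p.Prime] (h2 : 2 ≤ i) (hi : i < p) :
    (i : ZMod p)⁻¹ = ((p - p / i : ℕ) : ZMod p) * ((p % i : ℕ) : ZMod p)⁻¹ := by
  have hp := Fact.out (p := p.Prime)
  -- Otherwise `i` would be a divisor of `p` strictly between `1` and `p`.
  have h1 : p % i ≠ 0 := by
    intro h
    have := (Nat.dvd_prime hp).1 (Nat.dvd_of_mod_eq_zero h)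
    omega
  have hne : ∀ j < p, j ≠ 0 → (j : ZMod p) ≠ 0 := fun j hj hj0 h =>
    hj0 (Nat.eq_zero_of_dvd_of_lt ((ZMod.natCast_eq_zero_iff j p).1 h) hj)
  have h3 := congrArg (Nat.cast : ℕ → ZMod p) (Nat.div_add_mod p i)
  push_cast at h3
  rw [ZMod.natCast_self] at h3
  rw [Nat.cast_sub (Nat.div_le_self _ _), ZMod.natCast_self, zero_sub,
    eq_mul_inv_iff_mul_eq₀ (hne _ ((Nat.mod_lt _ (by omega)).trans hi) h1),
    inv_mul_eq_iff_eq_mul₀ (hne i hi (by omega))]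
  linear_combination h3

/-- The recurrence refers to an earlier entry, so one pass fills the table. Entry `0` is set to `1`
on purpose: a product of inverses over all indices then skips the index `0` without a test. -/
theorem inverseCmd_reaches {ω : ℕ → Bool} {L : ℕ} {s : State} {p : ℕ} [hp : Fact p.Prime]
    (h6 : s.mem 6 0 = p) (hL : p < 2 ^ L) :
    Reaches ω L inverseCmd s (4 * p + 2) fun s' =>
      s'.mem 7 0 = 1 ∧ ∀ i < p, s'.mem 7 i < p ∧ (i ≠ 0 → (s'.mem 7 i : ZMod p) = (i : ZMod p)⁻¹) := by
  have hp2 := hp.out.two_le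
  have main : Reaches ω L inverseCmd s (p * (2 + 2) + 2) fun s' =>
      s'.mem 7 0 = 1 ∧ ∀ i < p, s'.mem 7 i < p ∧ (i ≠ 0 → (s'.mem 7 i : ZMod p) = (i : ZMod p)⁻¹) := by
    refine Reaches.for_loop_const (fun k s' => (0 < k → s'.mem 7 0 = 1) ∧
      ∀ i < k, s'.mem 7 i < p ∧ (i ≠ 0 → (s'.mem 7 i : ZMod p) = (i : ZMod p)⁻¹)) 2 (by decide) hL
      ?_ ?_ ?_ ?_
    · intro s' h
      simp [h.mem 6 (by decide), h6]
    · simp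
    · rintro k s' hk h hv ⟨hI0, hI⟩
      have h6' : s'.mem 6 0 = p := by rw [h.mem 6 (by decide), h6]
      refine Reaches.ite (k := 1) ?_ ?_
      · intro he
        have he : k < 2 := by simpa [hv] using he
        refine Reaches.set ?_ ?_
        · simp only [Expr.eval_lit]; omega
        · simp only [State.store_mem, Expr.eval_var, Expr.eval_lit, hv, Function.update_apply,
            Nat.reduceEqDiff, if_true, if_false]
          refine ⟨fun _ => ?_, fun i hi => ?_⟩
          · split_ifs with hc
            · rfl
            · exact hI0 (by omega)
          · split_ifs with hc
            · refine ⟨by omega, fun h0 => ?_⟩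
              rw [show i = 1 by omega]; simp
            · exact hI i (by omega)
      · intro he
        have he : 2 ≤ k := by simpa [hv, Nat.succ_le_iff] using he
        refine Reaches.set ?_ ?_
        · simp only [Expr.eval_mod, Expr.eval_var, h6']
          exact (Nat.mod_lt _ (by omega)).trans hL
        · simp only [State.store_mem, Expr.eval_var, Expr.eval_mul, Expr.eval_sub,
            Expr.eval_mod, Expr.eval_div, Expr.eval_get, hv, h6', Function.update_apply,
            Nat.reduceEqDiff, if_true, if_false]
          refine ⟨fun _ => ?_, fun i hi => ?_⟩
          · rw [if_neg (by omega)]; exact hI0 (by omega)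
          · split_ifs with hc
            · refine ⟨Nat.mod_lt _ (by omega), fun h0 => ?_⟩
              subst hc
              have h1 : p % i ≠ 0 := by
                intro h
                have := (Nat.dvd_prime hp.out).1 (Nat.dvd_of_mod_eq_zero h)
                omega
              rw [ZMod.natCast_mod, Nat.cast_mul, (hI _ (Nat.mod_lt _ (by omega))).2 h1,
                ← ZMod.inv_natCast_eq he hk]
            · exact hI i (by omega)
    · rintro s' h ⟨hI0, hI⟩
      exact ⟨hI0 (by omega), hI⟩
  exact main.mono (by omega) fun _ _ h => h

/-! ## Lagrange interpolation at the nodes `0, 1, …, A - 1` -/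

section Lagrange

open Polynomial Finset

variable {F : Type*} [Field F]

/-- The value at `t` of the `i`-th Lagrange basis polynomial for the nodes `0, …, A - 1`. -/
noncomputable def lagrangeCoeff (F : Type*) [Field F] (A : ℕ) (t : F) (i : ℕ) : F :=
  (Lagrange.basis (range A) (fun j : ℕ => (j : F)) i).eval t

theorem nodalWeight_range (A i : ℕ) :
    Lagrange.nodalWeight (range A) (fun j : ℕ => (j : F)) i =
      ∏ j ∈ range A, if j = i then 1 else ((i : F) - j)⁻¹ := by
  rw [Lagrange.nodalWeight, ← prod_erase (a := i) (range A) (by simp)]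
  exact prod_congr rfl fun j hj => by rw [if_neg (ne_of_mem_erase hj)]

/-- Moving from `i` to `i + 1` shifts the window of differences by one: `i - (A - 1)` leaves and `i
+ 1` enters. All weights thus follow from the first one with a bounded number of multiplications
each. -/
theorem nodalWeight_range_succ {A i : ℕ} (hi : i + 1 < A) (h0 : ((A - 1 - i : ℕ) : F) ≠ 0)
    (h1 : ((i + 1 : ℕ) : F) ≠ 0) :
    Lagrange.nodalWeight (range A) (fun j : ℕ => (j : F)) (i + 1) =
      Lagrange.nodalWeight (range A) (fun j : ℕ => (j : F)) i * -((A - 1 - i : ℕ) : F) *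
        ((i + 1 : ℕ) : F)⁻¹ := by
  obtain ⟨a, rfl⟩ := Nat.exists_eq_add_of_le' (show 1 ≤ A by omega)
  simp only [nodalWeight_range, Nat.add_sub_cancel] at h0 ⊢
  rw [prod_range_succ', prod_range_succ, if_neg (by omega), if_neg (by omega)]
  have h2 : (i : F) - a = -((a - i : ℕ) : F) := by rw [Nat.cast_sub (by omega)]; ring
  simp only [add_left_inj, h2, Nat.cast_zero, sub_zero, Nat.cast_add, Nat.cast_one,
    add_sub_add_right_eq_sub]
  push_cast at h1
  field_simp

/-- The signs are arranged to match the loop of `weightsCmd`, which starts from `-1` and multiplies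
by a negated table entry in each round; the index `0`, which must not contribute, produces the
factor `-1` that the start cancels. -/
theorem nodalWeight_range_zero {a : ℕ} :
    Lagrange.nodalWeight (range (a + 1)) (fun j : ℕ => (j : F)) 0 =
      -∏ j ∈ range (a + 1), -(if j = 0 then 1 else (j : F)⁻¹) := by
  rw [nodalWeight_range, prod_range_succ', prod_range_succ']
  simp only [Nat.cast_add, Nat.cast_one, Nat.cast_zero, zero_sub, if_true, mul_one, Nat.add_eq_zero_iff,
    one_ne_zero, and_false, if_false, mul_neg, neg_neg, inv_neg]

theorem lagrangeCoeff_of_lt {A t : ℕ} (hA : Set.InjOn (fun j : ℕ => (j : F)) (range A))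
    (ht : t < A) {i : ℕ} (hi : i < A) : lagrangeCoeff F A t i = if i = t then 1 else 0 := by
  split_ifs with h
  · subst h; exact Lagrange.eval_basis_self hA (mem_range.2 hi)
  · exact Lagrange.eval_basis_of_ne h (mem_range.2 ht)

theorem lagrangeCoeff_of_ne {A i : ℕ} {t : F} (hi : i < A) (ht : ∀ j < A, t ≠ j) :
    lagrangeCoeff F A t i = (∏ j ∈ range A, (t - j)) *
      Lagrange.nodalWeight (range A) (fun j : ℕ => (j : F)) i * (t - i)⁻¹ := by
  rw [lagrangeCoeff, Lagrange.eval_basis_not_at_node (mem_range.2 hi) (ht i hi),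
    Lagrange.eval_nodal, mul_assoc]

theorem eval_interpolate_eq_sum (A : ℕ) (r : ℕ → F) (t : F) :
    (Lagrange.interpolate (range A) (fun j : ℕ => (j : F)) r).eval t =
      ∑ i ∈ range A, lagrangeCoeff F A t i * r i := by
  simp [Lagrange.interpolate_apply, eval_finsetSum, lagrangeCoeff, mul_comm]

/-! ## The counting polynomial -/

/-- The polynomial whose value at `i < n` is the number of the vectors `v 0, …, v (n - 1)` that are
orthogonal to `v i`. -/
noncomputable def countPoly (F : Type*) [Field F] (n d : ℕ) (v : ℕ → ℕ → ℕ) : F[X] :=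
  ∑ j ∈ range n, ∏ k ∈ range d,
    (1 - Lagrange.interpolate (range n) (fun i : ℕ => (i : F)) (fun i => (v i k : F)) * C (v j k : F))

theorem eval_countPoly (n d : ℕ) (v : ℕ → ℕ → ℕ) (t : F) :
    (countPoly F n d v).eval t = ∑ j ∈ range n, ∏ k ∈ range d,
      (1 - (∑ i ∈ range n, lagrangeCoeff F n t i * v i k) * v j k) := by
  simp only [countPoly, eval_finsetSum, eval_prod, eval_sub, eval_one, eval_mul, eval_C,
    eval_interpolate_eq_sum]

/-- At a node the interpolants return the bits of row `i`, so each product is the indicator of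
orthogonality to row `j`. -/
theorem eval_countPoly_natCast {n d : ℕ} {v : ℕ → ℕ → ℕ}
    (hn : Set.InjOn (fun j : ℕ => (j : F)) (range n)) (hv : ∀ i < n, ∀ k < d, v i k ≤ 1)
    {i : ℕ} (hi : i < n) :
    (countPoly F n d v).eval (i : F) =
      (#{j ∈ range n | ∀ k < d, v i k * v j k = 0} : ℕ) := by
  rw [card_filter, Nat.cast_sum]
  simp only [countPoly, eval_finsetSum, eval_prod]
  refine sum_congr rfl fun j hj => ?_
  have h1 : ∀ k < d, eval (i : F) (1 - Lagrange.interpolate (range n) (fun i : ℕ => (i : F))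
      (fun i => (v i k : F)) * C (v j k : F)) = if v i k * v j k = 0 then 1 else 0 := by
    intro k hk
    rw [eval_sub, eval_mul, eval_C, eval_one,
      Lagrange.eval_interpolate_at_node (v := fun i : ℕ => (i : F)) _ hn (mem_range.2 hi)]
    have h2 := hv i hi k hk
    have h3 := hv j (mem_range.1 hj) k hk
    interval_cases v i k <;> interval_cases v j k <;> simp
  rw [prod_congr rfl fun k hk => h1 k (mem_range.1 hk), prod_ite_zero]
  simp

/-- Each of the `d` factors has degree at most `n - 1`. The bound is strict because `d` is positive.
-/
theorem degree_countPoly_lt {n d : ℕ} {v : ℕ → ℕ → ℕ} (hn0 : 0 < n) (hd : 0 < d)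
    (hn : Set.InjOn (fun j : ℕ => (j : F)) (range n)) :
    (countPoly F n d v).degree < (n * d : ℕ) := by
  have h1 : (countPoly F n d v).natDegree ≤ (n - 1) * d := by
    refine natDegree_sum_le_of_forall_le _ _ fun j _ => ?_
    refine (natDegree_prod_le _ _).trans ?_
    refine (sum_le_card_nsmul _ _ (n - 1) fun k _ => ?_).trans (by simp [mul_comm])
    refine (natDegree_sub_le _ _).trans (max_le (by simp) ?_)
    refine (natDegree_mul_C_le _ _).trans ?_
    refine natDegree_le_iff_degree_le.2 ?_
    simpa using Lagrange.degree_interpolate_le (fun i => (v i k : F)) hn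
  refine degree_le_natDegree.trans_lt (Nat.cast_lt.2 (h1.trans_lt ?_))
  exact Nat.mul_lt_mul_of_pos_right (by omega) hd

theorem interpolate_eq_countPoly {n d : ℕ} {v : ℕ → ℕ → ℕ} (hn0 : 0 < n) (hd : 0 < d)
    (hN : Set.InjOn (fun j : ℕ => (j : F)) (range (n * d))) {r : ℕ → F}
    (hr : ∀ i < n * d, r i = (countPoly F n d v).eval (i : F)) :
    Lagrange.interpolate (range (n * d)) (fun j : ℕ => (j : F)) r = countPoly F n d v := by
  have hn : Set.InjOn (fun j : ℕ => (j : F)) (range n) :=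
    hN.mono (by simpa using Nat.le_mul_of_pos_right n hd)
  refine (Lagrange.eq_interpolate_of_eval_eq r hN ?_ fun i hi => ?_).symm
  · simpa using degree_countPoly_lt hn0 hd hn
  · exact (hr i (mem_range.1 hi)).symm

/-- The soundness principle: the interpolant of the claimed values and the counting polynomial both
have degree below `n * d`, so agreement at that many points makes them equal, and then all claimed
values are right. -/
theorem eval_eq_of_card_le {n d : ℕ} {v : ℕ → ℕ → ℕ} (hn0 : 0 < n) (hd : 0 < d)
    (hN : Set.InjOn (fun j : ℕ => (j : F)) (range (n * d))) {r : ℕ → F} {S : Finset ℕ}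
    (hS : Set.InjOn (fun j : ℕ => (j : F)) S) (hc : n * d ≤ #S)
    (h : ∀ t ∈ S, ∑ i ∈ range (n * d), lagrangeCoeff F (n * d) t i * r i =
      (countPoly F n d v).eval (t : F)) {i : ℕ} (hi : i < n * d) :
    r i = (countPoly F n d v).eval (i : F) := by
  have hn : Set.InjOn (fun j : ℕ => (j : F)) (range n) :=
    hN.mono (by simpa using Nat.le_mul_of_pos_right n hd)
  have hc' : ((n * d : ℕ) : WithBot ℕ) ≤ (#S : WithBot ℕ) := Nat.cast_le.2 hc
  have := eq_of_degrees_lt_of_eval_index_eq S (v := fun j : ℕ => (j : F)) hS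
    (f := Lagrange.interpolate (range (n * d)) (fun j : ℕ => (j : F)) r)
    (g := countPoly F n d v) (lt_of_lt_of_le (by simpa using Lagrange.degree_interpolate_lt r hN) hc')
    (lt_of_lt_of_le (degree_countPoly_lt hn0 hd hn) hc')
    (fun t ht => (eval_interpolate_eq_sum _ r _).trans (h t ht))
  rw [← this]
  exact (Lagrange.eval_interpolate_at_node (v := fun i : ℕ => (i : F)) r hN (mem_range.2 hi)).symm

end Lagrange

theorem ZMod.injOn_natCast (p : ℕ) {S : Set ℕ} (h : ∀ i ∈ S, i < p) :
    Set.InjOn (fun j : ℕ => (j : ZMod p)) S := by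
  intro i hi j hj hij
  have := (ZMod.natCast_eq_natCast_iff i j p).1 hij
  rwa [Nat.ModEq, Nat.mod_eq_of_lt (h i hi), Nat.mod_eq_of_lt (h j hj)] at this

/-! ## Evaluating the counting polynomial on the machine -/

/-- Array `6` holds `p`, and array `7` the inverses modulo `p`. -/
structure PrimeTable (p : ℕ) (s : State) : Prop where
  prime : s.mem 6 0 = p
  zero : s.mem 7 0 = 1
  lt : ∀ i < p, s.mem 7 i < p
  inv : ∀ i < p, i ≠ 0 → (s.mem 7 i : ZMod p) = (i : ZMod p)⁻¹

theorem PrimeTable.congr {p : ℕ} {s s' : State} (h : PrimeTable p s) (h6 : s'.mem 6 = s.mem 6)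
    (h7 : s'.mem 7 = s.mem 7) : PrimeTable p s' :=
  ⟨by rw [h6, h.prime], by rw [h7, h.zero], by rw [h7]; exact h.lt, by rw [h7]; exact h.inv⟩

/-- Subtraction on the machine is truncated, so residues are negated as `p - x`; this is why bounds
on residues are carried along. -/
theorem cast_sub_self {p x : ℕ} (h : x ≤ p) : ((p - x : ℕ) : ZMod p) = -x := by
  rw [Nat.cast_sub h, ZMod.natCast_self, zero_sub]

/-- With a number `A` of nodes in array `12` and a point `t` in array `13`, store the values at `t`
of the Lagrange basis polynomials in array `15`. -/
def weightsCmd : Cmd :=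
  .ite (.lt (.var 13) (.var 12))
    (.for 10 (.var 12) (.set 15 (.var 10) (.eq (.var 10) (.var 13))))
    (.assign 14 (.var 6 - .lit 1) ;;
      .for 10 (.var 12)
        (.assign 14 (.var 14 * ((.var 13 - .var 10) * (.var 6 - .get 7 (.var 10))) % .var 6)) ;;
      .for 10 (.var 12)
        (.set 15 (.var 10) (.var 14 * .get 7 (.var 13 - .var 10) % .var 6) ;;
          .assign 14 (.var 14 * (.var 6 - (.var 12 - .lit 1 - .var 10)) * .get 7 (.var 10 + .lit 1)
            % .var 6)))

/-- At a node the coefficients are zeros and a single one. Elsewhere the `i`-th coefficient is `∏ j,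
(t - j)` times the `i`-th nodal weight divided by `t - i`; array `14` carries the product of the
first two factors, updated by `nodalWeight_range_succ`. -/
theorem weightsCmd_reaches {ω : ℕ → Bool} {L : ℕ} {s : State} {p A t : ℕ} [hp : Fact p.Prime]
    (hs : PrimeTable p s) (hL : p < 2 ^ L) (hA : s.mem 12 0 = A) (ht : s.mem 13 0 = t)
    (hA0 : 0 < A) (hAp : A ≤ p) (htp : t < p) :
    Reaches ω L weightsCmd s (7 * A + 6) fun s' =>
      ∀ i < A, s'.mem 15 i < p ∧ (s'.mem 15 i : ZMod p) = lagrangeCoeff (ZMod p) A t i := by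
  have hp1 := hp.out.one_lt
  have main : Reaches ω L weightsCmd s ((1 + ((A * (1 + 2) + 2) + (A * (1 + 1 + 2) + 2))) + 1)
      fun s' => ∀ i < A, s'.mem 15 i < p ∧
        (s'.mem 15 i : ZMod p) = lagrangeCoeff (ZMod p) A t i := by
    refine Reaches.ite (fun he => ?_) (fun he => ?_)
    · have htA : t < A := by simpa [hA, ht] using he
      refine (Reaches.for_loop_const (N := A) (fun k s' => ∀ i < k, s'.mem 15 i < p ∧
        (s'.mem 15 i : ZMod p) = lagrangeCoeff (ZMod p) A t i) 1 (by decide) (by omega)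
        ?_ ?_ ?_ (fun _ _ h => h)).mono (by omega) fun _ _ h => h
      · intro s' h
        simp [h.mem 12 (by decide), hA]
      · simp
      · intro k s' hk h hv hI
        have h13 : s'.mem 13 0 = t := by rw [h.mem 13 (by decide), ht]
        refine Reaches.set ?_ ?_
        · rw [Expr.eval_eq]
          exact (ite_le_one le_rfl zero_le_one).trans_lt (hp1.trans hL)
        · simp only [State.store_mem, Expr.eval_eq, Expr.eval_var, hv, h13, Nat.reduceEqDiff,
            if_true, if_false]
          intro i hi
          rw [Function.update_apply]
          split_ifs with h1 h2
          · refine ⟨hp1, ?_⟩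
            rw [lagrangeCoeff_of_lt (ZMod.injOn_natCast p fun j hj => ?_) htA (by omega)]
            · simp [h1, h2]
            · exact (Finset.mem_range.1 hj).trans_le hAp
          · refine ⟨by omega, ?_⟩
            rw [lagrangeCoeff_of_lt (ZMod.injOn_natCast p fun j hj => ?_) htA (by omega)]
            · simp [h1, h2]
            · exact (Finset.mem_range.1 hj).trans_le hAp
          · exact hI i (by omega)
    · have htA : A ≤ t := by simpa [hA, ht] using he
      -- In this branch `t` lies beyond all nodes, so truncated subtraction is exact.
      have hsub : ∀ i < A, ((t - i : ℕ) : ZMod p) = t - i := fun i hi => Nat.cast_sub (by omega)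
      refine Reaches.seq (Reaches.assign ?_ ?_)
      · simp only [Expr.eval_sub, Expr.eval_var, Expr.eval_lit, hs.prime]; omega
      refine Reaches.seq (Reaches.for_loop_const (N := A) (fun k s' =>
        (s'.mem 14 0 : ZMod p) = -∏ j ∈ Finset.range k, ((t - j : ZMod p) *
          -(if j = 0 then 1 else (j : ZMod p)⁻¹))) 1 (by decide) (by omega) ?_ ?_ ?_ ?_)
      · intro s' h
        simp [h.mem 12 (by decide), hA]
      · simp only [State.store_mem, Nat.reduceEqDiff, if_true, if_false, Function.update_self,
          Expr.eval_sub, Expr.eval_var, Expr.eval_lit, hs.prime]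
        rw [cast_sub_self hp1.le]
        simp
      · intro k s' hk h hv hI
        have h13 : s'.mem 13 0 = t := by rw [h.mem 13 (by decide)]; simp [ht]
        have hs' : PrimeTable p s' :=
          hs.congr (by rw [h.mem 6 (by decide)]; simp) (by rw [h.mem 7 (by decide)]; simp)
        refine Reaches.assign ?_ ?_
        · simp only [Expr.eval_mod, Expr.eval_var, hs'.prime]
          exact (Nat.mod_lt _ (by omega)).trans hL
        · simp only [State.store_mem, Nat.reduceEqDiff, if_true, if_false, Function.update_self,
            Expr.eval_sub, Expr.eval_var, Expr.eval_mod, Expr.eval_get, Expr.eval_mul, hs'.prime,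
            hv, h13, ZMod.natCast_mod]
          rw [Nat.cast_mul, Nat.cast_mul, hI, hsub k hk, cast_sub_self (hs'.lt k (by omega)).le,
            Finset.prod_range_succ, neg_mul]
          congr 4
          split_ifs with h0
          · rw [h0, hs'.zero, Nat.cast_one]
          · exact hs'.inv k (by omega) h0
      · intro s₁ h₁ hI₁
        have hs₁ : PrimeTable p s₁ :=
          hs.congr (by rw [h₁.mem 6 (by decide)]; simp) (by rw [h₁.mem 7 (by decide)]; simp)
        have hA₁ : s₁.mem 12 0 = A := by rw [h₁.mem 12 (by decide)]; simp [hA]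
        have ht₁ : s₁.mem 13 0 = t := by rw [h₁.mem 13 (by decide)]; simp [ht]
        have hne : ∀ i < A, (t : ZMod p) ≠ i := by
          intro i hi h
          have := (ZMod.natCast_eq_natCast_iff t i p).1 h
          rw [Nat.ModEq, Nat.mod_eq_of_lt htp, Nat.mod_eq_of_lt (by omega)] at this
          omega
        have hne0 : ∀ i < p, i ≠ 0 → (i : ZMod p) ≠ 0 := fun j hj hj0 h =>
          hj0 (Nat.eq_zero_of_dvd_of_lt ((ZMod.natCast_eq_zero_iff j p).1 h) hj)
        -- The claim about array `14` stops at `k < A`: the last round may read the table of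
        -- inverses at index `A = p`, where its content is unspecified, and that product is never
        -- used.
        refine Reaches.for_loop_const (N := A) (fun k s' => (∀ i < k, s'.mem 15 i < p ∧
          (s'.mem 15 i : ZMod p) = lagrangeCoeff (ZMod p) A t i) ∧ (k < A →
          (s'.mem 14 0 : ZMod p) = (∏ j ∈ Finset.range A, (t - j : ZMod p)) *
            Lagrange.nodalWeight (Finset.range A) (fun j : ℕ => (j : ZMod p)) k))
          2 (by decide) (by omega) ?_ ?_ ?_ (fun _ _ h => h.1)
        · intro s' h
          simp [h.mem 12 (by decide), hA₁]
        · refine ⟨by simp, fun _ => ?_⟩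
          obtain ⟨a, rfl⟩ := Nat.exists_eq_add_of_le' (show 1 ≤ A by omega)
          rw [nodalWeight_range_zero, mul_neg, ← Finset.prod_mul_distrib, ← hI₁]
          simp
        · rintro k s' hk h hv ⟨hI, hI'⟩
          have h12 : s'.mem 12 0 = A := by rw [h.mem 12 (by decide), hA₁]
          have h13 : s'.mem 13 0 = t := by rw [h.mem 13 (by decide), ht₁]
          have hs' : PrimeTable p s' :=
            hs₁.congr (h.mem 6 (by decide)) (h.mem 7 (by decide))
          refine Reaches.seq (k₁ := 1) (k₂ := 1) (Reaches.set ?_ (Reaches.assign ?_ ?_))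
          · simp only [Expr.eval_mod, Expr.eval_var, hs'.prime]
            exact (Nat.mod_lt _ (by omega)).trans hL
          · simp only [Expr.eval_mod, Expr.eval_var, State.store_mem, Nat.reduceEqDiff, if_false,
              hs'.prime]
            exact (Nat.mod_lt _ (by omega)).trans hL
          · simp only [State.store_mem, Nat.reduceEqDiff, if_true, if_false, Function.update_self,
              Expr.eval_sub, Expr.eval_var, Expr.eval_mod, Expr.eval_get, Expr.eval_mul,
              Expr.eval_lit, Expr.eval_add, hs'.prime, hv, h12, h13, ZMod.natCast_mod]
            refine ⟨fun i hi => ?_, fun hk1 => ?_⟩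
            · rw [Function.update_apply]
              split_ifs with hik
              · subst hik
                refine ⟨Nat.mod_lt _ (by omega), ?_⟩
                rw [ZMod.natCast_mod, Nat.cast_mul, hI' hk, hs'.inv _ (by omega) (by omega),
                  hsub i hk, lagrangeCoeff_of_ne hk hne]
              · exact hI i (by omega)
            · rw [Nat.cast_mul, Nat.cast_mul, hI' hk, cast_sub_self (by omega),
                hs'.inv _ (by omega) (by omega),
                nodalWeight_range_succ hk1 (hne0 _ (by omega) (by omega))
                  (hne0 _ (by omega) (by omega))]
              ring
  exact main.mono (by omega) fun _ _ h => h

/-- Array `0` holds `n`, `d` and the entries `v i k`. -/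
structure HasInput (n d : ℕ) (v : ℕ → ℕ → ℕ) (s : State) : Prop where
  n_eq : s.mem 0 0 = n
  d_eq : s.mem 0 1 = d
  entry : ∀ i < n, ∀ k < d, s.mem 0 (2 + i * d + k) = v i k

theorem HasInput.congr {n d : ℕ} {v : ℕ → ℕ → ℕ} {s s' : State} (h : HasInput n d v s)
    (h0 : s'.mem 0 = s.mem 0) : HasInput n d v s' :=
  ⟨by rw [h0, h.n_eq], by rw [h0, h.d_eq], by rw [h0]; exact h.entry⟩

/-- The entry in row `i` and column `k` of the input. -/
def entryExpr (i k : Expr) : Expr := .get 0 (.lit 2 + i * .get 0 (.lit 1) + k)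

theorem HasInput.eval_entryExpr {n d : ℕ} {v : ℕ → ℕ → ℕ} {s : State} (h : HasInput n d v s)
    {e f : Expr} {i k : ℕ} (he : e.eval s.mem = i) (hf : f.eval s.mem = k) (hi : i < n)
    (hk : k < d) : (entryExpr e f).eval s.mem = v i k := by
  simp [entryExpr, he, hf, h.d_eq, h.entry i hi k hk]

/-- Store the interpolated coordinates `∑ i, L i * v i k` in array `16`. -/
def coordsCmd : Cmd :=
  .for 8 (.get 0 (.lit 1))
    (.assign 17 (.lit 0) ;;
      .for 9 (.get 0 (.lit 0))
        (.assign 17 ((.var 17 + .get 15 (.var 9) * entryExpr (.var 9) (.var 8)) % .var 6)) ;;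
      .set 16 (.var 8) (.var 17))

theorem coordsCmd_reaches {ω : ℕ → Bool} {L : ℕ} {s : State} {p n d : ℕ} {v : ℕ → ℕ → ℕ}
    {l : ℕ → ZMod p} (hp : 1 < p) (hs : HasInput n d v s) (h6 : s.mem 6 0 = p) (hL : p < 2 ^ L)
    (hn : n < 2 ^ L) (hd : d < 2 ^ L) (hl : ∀ i < n, (s.mem 15 i : ZMod p) = l i) :
    Reaches ω L coordsCmd s (d * (3 * n + 6) + 2) fun s' =>
      ∀ k < d, s'.mem 16 k < p ∧ (s'.mem 16 k : ZMod p) = ∑ i ∈ Finset.range n, l i * v i k := by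
  have main : Reaches ω L coordsCmd s (d * ((1 + ((n * (1 + 2) + 2) + 1)) + 2) + 2) fun s' =>
      ∀ k < d, s'.mem 16 k < p ∧ (s'.mem 16 k : ZMod p) = ∑ i ∈ Finset.range n, l i * v i k := by
    refine Reaches.for_loop_const (N := d) (fun k₀ s' => ∀ k < k₀, s'.mem 16 k < p ∧
      (s'.mem 16 k : ZMod p) = ∑ i ∈ Finset.range n, l i * v i k) _ (by decide) hd ?_ ?_ ?_
      (fun _ _ h => h)
    · intro s' h
      simp [h.mem 0 (by decide), hs.d_eq]
    · simp
    · intro k s' hk h hv hI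
      have hs' : HasInput n d v s' := hs.congr (h.mem 0 (by decide))
      refine Reaches.seq (Reaches.assign (by simp) ?_)
      refine Reaches.seq (Reaches.for_loop_const (N := n) (fun i₀ s'' => s''.mem 17 0 < p ∧
        (s''.mem 17 0 : ZMod p) = ∑ i ∈ Finset.range i₀, l i * v i k) 1 (by decide) hn ?_ ?_ ?_ ?_)
      · intro s'' h'
        simp [h'.mem 0 (by decide), hs'.n_eq]
      · simp; omega
      · rintro i s'' hi h' hv' ⟨hJ, hJ'⟩
        have hs'' : HasInput n d v s'' :=
          hs'.congr (by rw [h'.mem 0 (by decide)]; simp)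
        have h6' : s''.mem 6 0 = p := by
          rw [h'.mem 6 (by decide)]; simp [h.mem 6 (by decide), h6]
        have h15 : (s''.mem 15 i : ZMod p) = l i := by
          rw [h'.mem 15 (by decide)]; simp [h.mem 15 (by decide), hl i hi]
        have h8 : s''.mem 8 0 = k := by rw [h'.mem 8 (by decide)]; simp [hv]
        have hent := hs''.eval_entryExpr (e := .var 9) (f := .var 8) hv' h8 hi hk
        refine Reaches.assign ?_ ?_
        · simp only [Expr.eval_mod, Expr.eval_var, h6']
          exact (Nat.mod_lt _ (by omega)).trans hL
        · simp only [State.store_mem, Nat.reduceEqDiff, if_true, if_false, Function.update_self,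
            Expr.eval_var, Expr.eval_mod, Expr.eval_get, Expr.eval_mul, Expr.eval_add, h6', hv',
            hent, ZMod.natCast_mod]
          refine ⟨Nat.mod_lt _ (by omega), ?_⟩
          rw [Nat.cast_add, Nat.cast_mul, hJ', h15, Finset.sum_range_succ]
      · rintro s'' h' ⟨hJ, hJ'⟩
        have h8 : s''.mem 8 0 = k := by rw [h'.mem 8 (by decide)]; simp [hv]
        have h16 : s''.mem 16 = s'.mem 16 := by rw [h'.mem 16 (by decide)]; simp
        refine Reaches.set ?_ ?_
        · simp only [Expr.eval_var]; omega
        · simp only [State.store_mem, Nat.reduceEqDiff, if_true, if_false, Expr.eval_var, h8, h16]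
          intro j hj
          rw [Function.update_apply]
          split_ifs with hjk
          · rw [hjk]; exact ⟨hJ, hJ'⟩
          · exact hI j (by omega)
  exact main.mono (by apply le_of_eq; ring) fun _ _ h => h

/-- Store `∑ j, ∏ k, (1 - x k * v j k)` in array `18`, where `x` is the content of array `16`. -/
def countCmd : Cmd :=
  .assign 18 (.lit 0) ;;
  .for 8 (.get 0 (.lit 0))
    (.assign 17 (.lit 1) ;;
      .for 9 (.get 0 (.lit 1))
        (.assign 17 (.var 17 * (.lit 1 + (.var 6 - .get 16 (.var 9)) * entryExpr (.var 8) (.var 9))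
          % .var 6)) ;;
      .assign 18 ((.var 18 + .var 17) % .var 6))

/-- The hypothesis that the coordinates are below `p` is what makes `p - x` represent `-x` in each
factor. -/
theorem countCmd_reaches {ω : ℕ → Bool} {L : ℕ} {s : State} {p n d : ℕ} {v : ℕ → ℕ → ℕ}
    {x : ℕ → ZMod p} (hp : 1 < p) (hs : HasInput n d v s) (h6 : s.mem 6 0 = p) (hL : p < 2 ^ L)
    (hn : n < 2 ^ L) (hd : d < 2 ^ L)
    (hx : ∀ k < d, s.mem 16 k < p ∧ (s.mem 16 k : ZMod p) = x k) :
    Reaches ω L countCmd s (n * (3 * d + 6) + 3) fun s' => s'.mem 18 0 < p ∧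
      (s'.mem 18 0 : ZMod p) =
        ∑ j ∈ Finset.range n, ∏ k ∈ Finset.range d, (1 - x k * v j k) := by
  have main : Reaches ω L countCmd s (1 + (n * ((1 + ((d * (1 + 2) + 2) + 1)) + 2) + 2))
      fun s' => s'.mem 18 0 < p ∧ (s'.mem 18 0 : ZMod p) =
        ∑ j ∈ Finset.range n, ∏ k ∈ Finset.range d, (1 - x k * v j k) := by
    refine Reaches.seq (Reaches.assign (by simp) ?_)
    refine Reaches.for_loop_const (N := n) (fun j₀ s' => s'.mem 18 0 < p ∧
      (s'.mem 18 0 : ZMod p) =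
        ∑ j ∈ Finset.range j₀, ∏ k ∈ Finset.range d, (1 - x k * v j k)) _ (by decide) hn ?_ ?_ ?_
      (fun _ _ h => h)
    · intro s' h
      simp [h.mem 0 (by decide), hs.n_eq]
    · simp; omega
    · rintro j s' hj h hv ⟨hI, hI'⟩
      have hs' : HasInput n d v s' := hs.congr (by rw [h.mem 0 (by decide)]; simp)
      have h6' : s'.mem 6 0 = p := by rw [h.mem 6 (by decide)]; simp [h6]
      refine Reaches.seq (Reaches.assign (by simp only [Expr.eval_lit]; omega) ?_)
      refine Reaches.seq (Reaches.for_loop_const (N := d) (fun k₀ s'' => s''.mem 17 0 < p ∧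
        (s''.mem 17 0 : ZMod p) = ∏ k ∈ Finset.range k₀, (1 - x k * v j k)) 1 (by decide) hd
        ?_ ?_ ?_ ?_)
      · intro s'' h'
        simp [h'.mem 0 (by decide), hs'.d_eq]
      · simpa using hp
      · rintro k s'' hk h' hv' ⟨hJ, hJ'⟩
        have hs'' : HasInput n d v s'' := hs'.congr (by rw [h'.mem 0 (by decide)]; simp)
        have h6'' : s''.mem 6 0 = p := by rw [h'.mem 6 (by decide)]; simp [h6']
        have h16 : s''.mem 16 = s.mem 16 := by
          rw [h'.mem 16 (by decide)]; simp [h.mem 16 (by decide)]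
        have h8 : s''.mem 8 0 = j := by rw [h'.mem 8 (by decide)]; simp [hv]
        have hent := hs''.eval_entryExpr (e := .var 8) (f := .var 9) h8 hv' hj hk
        refine Reaches.assign ?_ ?_
        · simp only [Expr.eval_mod, Expr.eval_var, h6'']
          exact (Nat.mod_lt _ (by omega)).trans hL
        · simp only [State.store_mem, Nat.reduceEqDiff, if_true, if_false, Function.update_self,
            Expr.eval_var, Expr.eval_mod, Expr.eval_get, Expr.eval_mul, Expr.eval_add,
            Expr.eval_sub, Expr.eval_lit, h6'', hv', hent, h16, ZMod.natCast_mod]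
          refine ⟨Nat.mod_lt _ (by omega), ?_⟩
          rw [Nat.cast_mul, Nat.cast_add, Nat.cast_mul, hJ', cast_sub_self (hx k hk).1.le,
            (hx k hk).2, Finset.prod_range_succ, Nat.cast_one, neg_mul, ← sub_eq_add_neg]
      · rintro s'' h' ⟨hJ, hJ'⟩
        have h6'' : s''.mem 6 0 = p := by rw [h'.mem 6 (by decide)]; simp [h6']
        have h18 : s''.mem 18 = s'.mem 18 := by rw [h'.mem 18 (by decide)]; simp
        refine Reaches.assign ?_ ?_
        · simp only [Expr.eval_mod, Expr.eval_var, h6'']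
          exact (Nat.mod_lt _ (by omega)).trans hL
        · simp only [State.store_mem, Nat.reduceEqDiff, if_true, if_false, Function.update_self,
            Expr.eval_var, Expr.eval_mod, Expr.eval_add, h6'', h18, ZMod.natCast_mod]
          refine ⟨Nat.mod_lt _ (by omega), ?_⟩
          rw [Nat.cast_add, hI', hJ', Finset.sum_range_succ]
  exact main.mono (by apply le_of_eq; ring) fun _ _ h => h

/-- Evaluate the counting polynomial at the point in array `13`; the result is in array `18`. -/
def evalCmd : Cmd :=
  .assign 12 (.get 0 (.lit 0)) ;; weightsCmd ;; coordsCmd ;; countCmd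

/-- Lagrange coefficients take `O(n)` steps and are shared by all `d` coordinates; the coordinates
and the sum of products take `O(n * d)` steps each. -/
theorem evalCmd_reaches {ω : ℕ → Bool} {L : ℕ} {s : State} {p n d t : ℕ} {v : ℕ → ℕ → ℕ}
    [hp : Fact p.Prime] (hs : PrimeTable p s) (hin : HasInput n d v s) (hL : p < 2 ^ L)
    (hd : d < 2 ^ L) (ht : s.mem 13 0 = t) (hn0 : 0 < n) (hd0 : 0 < d) (hnp : n ≤ p) (htp : t < p) :
    Reaches ω L evalCmd s (37 * (n * d)) fun s' => s'.mem 18 0 < p ∧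
      (s'.mem 18 0 : ZMod p) = (countPoly (ZMod p) n d v).eval (t : ZMod p) := by
  have main : Reaches ω L evalCmd s
      (1 + ((7 * n + 6) + ((d * (3 * n + 6) + 2) + (n * (3 * d + 6) + 3))))
      fun s' => s'.mem 18 0 < p ∧
      (s'.mem 18 0 : ZMod p) = (countPoly (ZMod p) n d v).eval (t : ZMod p) := by
    refine Reaches.seq (Reaches.assign ?_ ?_)
    · simp only [Expr.eval_get, Expr.eval_lit, hin.n_eq]; omega
    refine Reaches.seq ((weightsCmd_reaches (p := p) (A := n) (t := t)
      (hs.congr (by simp) (by simp)) hL (by simp [hin.n_eq]) (by simp [ht]) hn0 hnp htp).mono le_rfl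
      fun s₁ h₁ hw => ?_)
    have hin₁ : HasInput n d v s₁ := hin.congr (by rw [h₁.mem 0 (by decide)]; simp)
    have h6₁ : s₁.mem 6 0 = p := by rw [h₁.mem 6 (by decide)]; simp [hs.prime]
    refine Reaches.seq ((coordsCmd_reaches hp.out.one_lt hin₁ h6₁ hL (by omega) hd
      fun i hi => (hw i hi).2).mono le_rfl fun s₂ h₂ hc => ?_)
    refine (countCmd_reaches hp.out.one_lt (hin₁.congr (h₂.mem 0 (by decide)))
      (by rw [h₂.mem 6 (by decide), h6₁]) hL (by omega) hd hc).mono le_rfl fun s₃ h₃ hq => ?_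
    rwa [eval_countPoly]
  refine main.mono ?_ fun _ _ h => h
  have h1 : n ≤ n * d := Nat.le_mul_of_pos_right n hd0
  have h2 : d ≤ n * d := Nat.le_mul_of_pos_left d hn0
  nlinarith

/-! ## The common first phase of the verifier and the prover -/

/-- The number of coins of the verifier, when the input has `N` entries. -/
def coinCount (N : ℕ) : ℕ := Nat.clog 2 (4 * N)

/-- The modulus, when the input has `N` entries. -/
noncomputable def modulus (N : ℕ) : ℕ := primeAbove (2 ^ coinCount N)

instance (N : ℕ) : Fact (modulus N).Prime := ⟨(primeAbove_spec _).1⟩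

theorem le_two_pow_coinCount (N : ℕ) : 4 * N ≤ 2 ^ coinCount N := Nat.le_pow_clog one_lt_two _

theorem two_pow_coinCount_lt {N : ℕ} (hN : 0 < N) : 2 ^ coinCount N < 8 * N := by
  have h1 := Nat.pow_pred_clog_lt_self one_lt_two (show 1 < 4 * N by omega)
  have h2 : 0 < coinCount N := Nat.clog_pos one_lt_two (by omega)
  rw [coinCount] at h2 ⊢
  obtain ⟨w, hw⟩ := Nat.exists_eq_add_of_le' h2
  rw [hw, Nat.pred_succ] at h1
  rw [hw, pow_succ]
  omega

theorem lt_modulus (N : ℕ) : 2 ^ coinCount N < modulus N := (primeAbove_spec _).2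

theorem modulus_le (N : ℕ) : modulus N ≤ 2 * 2 ^ coinCount N :=
  primeAbove_le_two_mul (pow_ne_zero _ two_ne_zero)

theorem coinCount_le (N : ℕ) : coinCount N ≤ Nat.log 2 N + 3 := by
  refine Nat.clog_le_of_le_pow ?_
  have := Nat.lt_pow_succ_log_self one_lt_two N
  have h : 2 ^ (Nat.log 2 N + 3) = 4 * 2 ^ (Nat.log 2 N + 1) := by ring
  omega

/-- The state after the first phase, for an input with `n` rows and `d` columns. -/
structure Ready (n d : ℕ) (v : ℕ → ℕ → ℕ) (s : State) : Prop where
  input : HasInput n d v s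
  table : PrimeTable (modulus (n * d)) s
  size_eq : s.mem 2 0 = n * d
  coins_eq : s.mem 4 0 = coinCount (n * d)

theorem Ready.congr {n d : ℕ} {v : ℕ → ℕ → ℕ} {s s' : State} (h : Ready n d v s)
    (h' : ∀ a ∈ [0, 2, 4, 6, 7], s'.mem a = s.mem a) : Ready n d v s' :=
  ⟨h.input.congr (h' 0 (by decide)), h.table.congr (h' 6 (by decide)) (h' 7 (by decide)),
    by rw [h' 2 (by decide), h.size_eq], by rw [h' 4 (by decide), h.coins_eq]⟩

theorem Ready.frame {n d : ℕ} {v : ℕ → ℕ → ℕ} {s s' : State} {c : Cmd} (h : Ready n d v s)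
    (hf : Frame c s s') (hc : ∀ a ∈ [0, 2, 4, 6, 7], a ∉ c.writes) : Ready n d v s' :=
  h.congr fun a ha => hf.mem a (hc a ha)

theorem Ready.store {n d : ℕ} {v : ℕ → ℕ → ℕ} {s : State} (h : Ready n d v s) {a i x : ℕ}
    (ha : a ∉ [0, 2, 4, 6, 7]) : Ready n d v (s.store a i x) :=
  h.congr fun b hb => State.store_mem_of_ne _ _ _ (by rintro rfl; exact ha hb)

/-- The common first phase. -/
def setupCmd : Cmd := sizesCmd ;; sieveCmd ;; primeCmd ;; inverseCmd

/-- The sieve dominates: the modulus is linear in `n * d`, so every other phase takes linearly many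
steps. -/
theorem setupCmd_reaches {ω : ℕ → Bool} {L : ℕ} {s : State} {n d : ℕ} {v : ℕ → ℕ → ℕ}
    (hs : HasInput n d v s) (h5 : ∀ c, s.mem 5 c = 0) (hN : 0 < n * d)
    (hL : 32 * (n * d) + 32 ≤ 2 ^ L) :
    Reaches ω L setupCmd s (600 * (n * d) * (Nat.log 2 (n * d) + 1)) fun s' => Ready n d v s' := by
  have hM := le_two_pow_coinCount (n * d)
  have hM' := two_pow_coinCount_lt hN
  have hp := modulus_le (n * d)
  set M := 2 ^ coinCount (n * d) with hMdef
  have main : Reaches ω L setupCmd s ((20 * (n * d) + 5) +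
      ((6 * M * (Nat.log 2 (2 * M + 1) + 2) + 2) + ((12 * M + 9) + (4 * modulus (n * d) + 2))))
      fun s' => Ready n d v s' := by
    refine Reaches.seq ((sizesCmd_reaches hs.n_eq hs.d_eq hL).mono le_rfl ?_)
    rintro s₁ hf₁ ⟨h2, h4, h3⟩
    refine Reaches.seq ((sieveCmd_reaches (M := M) h3 (by rw [hf₁.mem 5 (by decide)]; exact h5)
      (by omega)).mono le_rfl fun s₂ hf₂ h5₂ => ?_)
    refine Reaches.seq ((primeCmd_reaches (M := M) (by rw [hf₂.mem 3 (by decide), h3]; rfl)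
      (by omega) h5₂ (by omega)).mono le_rfl fun s₃ hf₃ h6 => ?_)
    refine (inverseCmd_reaches (p := modulus (n * d)) h6 (by omega)).mono le_rfl ?_
    rintro s₄ hf₄ ⟨h7, h7'⟩
    refine ⟨hs.congr ?_, ⟨?_, h7, fun i hi => (h7' i hi).1, fun i hi => (h7' i hi).2⟩, ?_, ?_⟩
    · rw [hf₄.mem 0 (by decide), hf₃.mem 0 (by decide), hf₂.mem 0 (by decide),
        hf₁.mem 0 (by decide)]
    · rw [hf₄.mem 6 (by decide), h6]; rfl
    · rw [hf₄.mem 2 (by decide), hf₃.mem 2 (by decide), hf₂.mem 2 (by decide), h2]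
    · rw [hf₄.mem 4 (by decide), hf₃.mem 4 (by decide), hf₂.mem 4 (by decide), h4]; rfl
  refine main.mono ?_ fun _ _ h => h
  -- Since `M < 8 * (n * d)`, the number `2 * M + 1` is below `16 * (n * d)`.
  have hlog : Nat.log 2 (2 * M + 1) ≤ Nat.log 2 (n * d) + 4 := by
    refine Nat.lt_succ_iff.1 (Nat.log_lt_of_lt_pow (by omega) ?_)
    have := Nat.lt_pow_succ_log_self one_lt_two (n * d)
    have h : 2 ^ (Nat.log 2 (n * d) + 4 + 1) = 16 * 2 ^ (Nat.log 2 (n * d) + 1) := by ring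
    simp only [Nat.succ_eq_add_one]
    omega
  have h1 : 6 * M * (Nat.log 2 (2 * M + 1) + 2) ≤ 48 * (n * d) * (Nat.log 2 (n * d) + 6) :=
    Nat.mul_le_mul (by omega) (by omega)
  have h2 : 20 * (n * d) + 5 + (2 + ((12 * M + 9) + (4 * modulus (n * d) + 2))) ≤
      198 * (n * d) := by omega
  nlinarith [Nat.zero_le (n * d * Nat.log 2 (n * d))]

/-! ## The prover -/

/-- The value at `i` of the counting polynomial modulo the prime. -/
noncomputable def countValue (n d : ℕ) (v : ℕ → ℕ → ℕ) (i : ℕ) : ℕ :=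
  ((countPoly (ZMod (modulus (n * d))) n d v).eval (i : ZMod (modulus (n * d)))).val

/-- The `m`-th bit of the honest message. -/
noncomputable def messageBit (n d : ℕ) (v : ℕ → ℕ → ℕ) (m : ℕ) : ℕ :=
  countValue n d v (m / (coinCount (n * d) + 1)) / 2 ^ (m % (coinCount (n * d) + 1)) % 2

/-- The prover: write the values of the counting polynomial at `0, …, n * d - 1` in binary. -/
def proverCmd : Cmd :=
  setupCmd ;;
  .for 13 (.var 2)
    (evalCmd ;;
      .for 9 (.var 4 + .lit 1) (.write (.var 18 % .lit 2) ;; .assign 18 (.var 18 / .lit 2)))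

/-- There are `n * d` evaluations of `O(n * d)` steps each. Binary digits are written from the least
significant one by repeated halving, `coinCount (n * d) + 1` per value. -/
theorem proverCmd_reaches {ω : ℕ → Bool} {L : ℕ} {s : State} {n d : ℕ} {v : ℕ → ℕ → ℕ}
    (hs : HasInput n d v s) (h5 : ∀ c, s.mem 5 c = 0) (hout : s.out = []) (hn : 0 < n) (hd : 0 < d)
    (hL : 32 * (n * d) + 32 ≤ 2 ^ L) :
    Reaches ω L proverCmd s (1000 * (n * d) ^ 2 * (Nat.log 2 (n * d) + 1)) fun s' =>
      s'.out = (List.range (n * d * (coinCount (n * d) + 1))).map (messageBit n d v) := by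
  have hN : 0 < n * d := Nat.mul_pos hn hd
  have hM := le_two_pow_coinCount (n * d)
  have hM' := two_pow_coinCount_lt hN
  have hpM := lt_modulus (n * d)
  have hp := modulus_le (n * d)
  have hw := coinCount_le (n * d)
  have hwlt : coinCount (n * d) < 2 ^ coinCount (n * d) := Nat.lt_two_pow_self
  have hnN : n ≤ n * d := Nat.le_mul_of_pos_right n hd
  have hdN : d ≤ n * d := Nat.le_mul_of_pos_left d hn
  have main : Reaches ω L proverCmd s (600 * (n * d) * (Nat.log 2 (n * d) + 1) +
      (n * d * ((37 * (n * d) + ((coinCount (n * d) + 1) * (1 + 1 + 2) + 2)) + 2) + 2)) fun s' =>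
      s'.out = (List.range (n * d * (coinCount (n * d) + 1))).map (messageBit n d v) := by
    refine Reaches.seq ((setupCmd_reaches hs h5 hN hL).mono le_rfl fun s₁ hf₁ h₁ => ?_)
    refine Reaches.for_loop_const (N := n * d) (fun t s' =>
      s'.out = (List.range (t * (coinCount (n * d) + 1))).map (messageBit n d v)) _ (by decide)
      (by omega) ?_ ?_ ?_ (fun _ _ h => h)
    · intro s' h
      simp [h.mem 2 (by decide), h₁.size_eq]
    · simp [hf₁.out (by decide), hout]
    · intro t s' ht h hv hI
      have hs' : Ready n d v s' := h₁.frame h (by decide)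
      refine Reaches.seq ((evalCmd_reaches (p := modulus (n * d)) hs'.table hs'.input (by omega)
        (by omega) hv hn hd (by omega) (by omega)).mono le_rfl ?_)
      rintro s₂ hf₂ ⟨h18, h18'⟩
      have h18 : s₂.mem 18 0 = countValue n d v t := by
        rw [countValue, ← h18', ZMod.val_natCast_of_lt h18]
      have hs₂ : Ready n d v s₂ := hs'.frame hf₂ (by decide)
      refine Reaches.for_loop_const (N := coinCount (n * d) + 1) (fun b s'' =>
        s''.out = (List.range (t * (coinCount (n * d) + 1) + b)).map (messageBit n d v) ∧
        s''.mem 18 0 = countValue n d v t / 2 ^ b) _ (by decide) (by omega) ?_ ?_ ?_ ?_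
      · intro s'' h'
        simp [h'.mem 4 (by decide), hs₂.coins_eq]
      · simp [hf₂.out (by decide), hI, h18]
      · rintro b s'' hb h' hv' ⟨hJ, hJ'⟩
        have hbit : messageBit n d v (t * (coinCount (n * d) + 1) + b) =
            countValue n d v t / 2 ^ b % 2 := by
          rw [messageBit, mul_comm t, Nat.mul_add_div (by omega), Nat.mul_add_mod,
            Nat.div_eq_of_lt hb, Nat.mod_eq_of_lt hb, add_zero]
        -- Halving cannot exceed the bit bound, since the cell already satisfies it.
        refine Reaches.seq (Reaches.write (Reaches.bounded fun hb' => Reaches.assign ?_ ?_))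
        · exact (Nat.div_le_self _ _).trans_lt (hb' 18 0)
        · simp only [State.store_mem, State.store_out, Nat.reduceEqDiff, if_true, if_false,
            Function.update_self, Expr.eval_var, Expr.eval_div, Expr.eval_mod, Expr.eval_lit, hJ,
            hJ', Nat.div_div_eq_div_mul, ← pow_succ]
          rw [← add_assoc, List.range_succ, List.map_append, List.map_singleton, hbit]
          exact ⟨rfl, trivial⟩
      · rintro s'' h' ⟨hJ, hJ'⟩
        rw [State.store_out, hJ, add_one_mul]
  refine main.mono ?_ fun _ _ h => h
  have key : ∀ N l w : ℕ, 0 < N → w ≤ l + 3 → 600 * N * (l + 1) +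
      (N * ((37 * N + ((w + 1) * (1 + 1 + 2) + 2)) + 2) + 2) ≤ 1000 * N ^ 2 * (l + 1) := by
    intro N l w hN hw
    have h1 : N ≤ N ^ 2 := Nat.le_self_pow two_ne_zero _
    have h2 : N * l ≤ N ^ 2 * l := Nat.mul_le_mul_right _ h1
    have h3 : N * w ≤ N * (l + 3) := Nat.mul_le_mul_left _ hw
    nlinarith
  exact key _ _ _ hN hw

/-! ## The verifier -/

/-- The `i`-th number in a message that consists of blocks of `w + 1` bits. -/
def messageNumber (m : ℕ → ℕ) (w i : ℕ) : ℕ :=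
  ∑ b ∈ Finset.range (w + 1), 2 ^ b * m (i * (w + 1) + b)

/-- Read the numbers in the message, and store them modulo the prime in array `19`. -/
def readCmd : Cmd :=
  .for 8 (.var 2)
    (.assign 17 (.lit 0) ;; .assign 20 (.lit 1) ;;
      .for 9 (.var 4 + .lit 1)
        (.assign 17 (.var 17 + .var 20 * .get 1 (.var 8 * (.var 4 + .lit 1) + .var 9)) ;;
          .assign 20 (.lit 2 * .var 20)) ;;
      .set 19 (.var 8) (.var 17 % .var 6))

/-- Only the first `n * d` blocks are read, so long messages cost nothing extra. Reduction modulo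
the prime turns every message, however malformed, into a list of residues. -/
theorem readCmd_reaches {ω : ℕ → Bool} {L : ℕ} {s : State} {n d : ℕ} {v : ℕ → ℕ → ℕ}
    (hs : Ready n d v s) (hm : ∀ i, s.mem 1 i ≤ 1) (hN : 0 < n * d)
    (hL : 32 * (n * d) + 32 ≤ 2 ^ L) :
    Reaches ω L readCmd s (n * d * (4 * coinCount (n * d) + 11) + 2) fun s' =>
      ∀ i < n * d, s'.mem 19 i =
        messageNumber (s.mem 1) (coinCount (n * d)) i % modulus (n * d) := by
  have hM := le_two_pow_coinCount (n * d)
  have hM' := two_pow_coinCount_lt hN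
  have hp := modulus_le (n * d)
  have hp0 := (Fact.out : (modulus (n * d)).Prime).pos
  set w := coinCount (n * d) with hw
  have hwlt : w < 2 ^ w := Nat.lt_two_pow_self
  have hw2 : 2 ^ (w + 1) = 2 * 2 ^ w := pow_succ' _ _
  have main : Reaches ω L readCmd s
      (n * d * ((1 + (1 + (((w + 1) * (1 + 1 + 2) + 2) + 1))) + 2) + 2) fun s' =>
      ∀ i < n * d, s'.mem 19 i = messageNumber (s.mem 1) w i % modulus (n * d) := by
    refine Reaches.for_loop_const (N := n * d) (fun k s' =>
      ∀ i < k, s'.mem 19 i = messageNumber (s.mem 1) w i % modulus (n * d)) _ (by decide)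
      (by omega) ?_ ?_ ?_ (fun _ _ h => h)
    · intro s' h
      simp [h.mem 2 (by decide), hs.size_eq]
    · simp
    · intro i s' hi h hv hI
      have hs' : Ready n d v s' := hs.frame h (by decide)
      have h1 : s'.mem 1 = s.mem 1 := h.mem 1 (by decide)
      refine Reaches.seq (Reaches.assign (by simp) ?_)
      refine Reaches.seq (Reaches.assign (by simp only [Expr.eval_lit]; omega) ?_)
      refine Reaches.seq (Reaches.for_loop_const (N := w + 1) (fun b₀ s'' =>
        s''.mem 20 0 = 2 ^ b₀ ∧ s''.mem 17 0 < 2 ^ b₀ ∧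
        s''.mem 17 0 = ∑ b ∈ Finset.range b₀, 2 ^ b * s.mem 1 (i * (w + 1) + b))
        _ (by decide) (by omega) ?_ ?_ ?_ ?_)
      · intro s'' h'
        simp [h'.mem 4 (by decide), hs'.coins_eq, hw]
      · simp
      · rintro b s'' hb h' hv' ⟨h20, h17, h17'⟩
        have h4 : s''.mem 4 0 = w := by rw [h'.mem 4 (by decide)]; simp [hs'.coins_eq, hw]
        have h8 : s''.mem 8 0 = i := by rw [h'.mem 8 (by decide)]; simp [hv]
        have h1' : s''.mem 1 = s.mem 1 := by rw [h'.mem 1 (by decide)]; simp [h1]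
        -- The first `b` bits of a block form a number below `2 ^ b`, so the accumulator keeps
        -- within the bit bound.
        have hlt : s''.mem 17 0 + 2 ^ b * s.mem 1 (i * (w + 1) + b) < 2 ^ (b + 1) := by
          have := Nat.mul_le_mul_left (2 ^ b) (hm (i * (w + 1) + b))
          rw [pow_succ]; omega
        have hle : 2 ^ (b + 1) ≤ 2 ^ (w + 1) := Nat.pow_le_pow_right two_pos (by omega)
        refine Reaches.seq (Reaches.assign ?_ (Reaches.assign ?_ ?_))
        · simp only [Expr.eval_add, Expr.eval_mul, Expr.eval_get, Expr.eval_var, Expr.eval_lit,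
            h20, h8, h4, hv', h1']
          omega
        · simp only [Expr.eval_mul, Expr.eval_var, Expr.eval_lit, State.store_mem,
            Nat.reduceEqDiff, if_false, h20, ← pow_succ']
          omega
        · simp only [Expr.eval_add, Expr.eval_mul, Expr.eval_get, Expr.eval_var, Expr.eval_lit,
            h20, h8, h4, hv', h1', State.store_mem, Nat.reduceEqDiff, if_false, if_true,
            Function.update_self]
          exact ⟨(pow_succ' _ _).symm, hlt, by rw [Finset.sum_range_succ, h17']⟩
      · rintro s'' h' ⟨h20, h17, h17'⟩
        have h6 : s''.mem 6 0 = modulus (n * d) := by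
          rw [h'.mem 6 (by decide)]; simp [hs'.table.prime]
        have h8 : s''.mem 8 0 = i := by rw [h'.mem 8 (by decide)]; simp [hv]
        have h19 : s''.mem 19 = s'.mem 19 := by rw [h'.mem 19 (by decide)]; simp
        refine Reaches.set ?_ ?_
        · simp only [Expr.eval_mod, Expr.eval_var, h6]
          have := Nat.mod_lt (s''.mem 17 0) hp0
          omega
        · simp only [Expr.eval_mod, Expr.eval_var, h6, h8, h19, State.store_mem, Nat.reduceEqDiff,
            if_false, if_true, Function.update_apply]
          intro j hj
          split_ifs with hji
          · rw [hji, h17', messageNumber]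
          · exact hI j (by omega)
  exact main.mono (by apply le_of_eq; ring) fun _ _ h => h

/-- The number whose binary digits are the first `w` coins. -/
def coinNumber (ω : ℕ → Bool) : ℕ → ℕ
  | 0 => 0
  | w + 1 => 2 * coinNumber ω w + (ω w).toNat

theorem coinNumber_lt (ω : ℕ → Bool) (w : ℕ) : coinNumber ω w < 2 ^ w := by
  induction w with
  | zero => simp [coinNumber]
  | succ w ih =>
    have := (ω w).toNat_le
    rw [coinNumber, pow_succ]
    omega

/-- Draw a random point, and store it in array `13`. -/
def drawCmd : Cmd :=
  .assign 13 (.lit 0) ;;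
  .for 8 (.var 4) (.flip 17 (.lit 0) ;; .assign 13 (.lit 2 * .var 13 + .var 17))

theorem drawCmd_reaches {ω : ℕ → Bool} {L : ℕ} {s : State} {w : ℕ} (h4 : s.mem 4 0 = w)
    (hpos : s.pos = 0) (hL : 2 ^ w < 2 ^ L) :
    Reaches ω L drawCmd s (4 * w + 3) fun s' => s'.mem 13 0 = coinNumber ω w := by
  have hwlt : w < 2 ^ w := Nat.lt_two_pow_self
  have main : Reaches ω L drawCmd s (1 + (w * (1 + 1 + 2) + 2)) fun s' =>
      s'.mem 13 0 = coinNumber ω w := by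
    refine Reaches.seq (Reaches.assign (by simp) ?_)
    refine Reaches.for_loop_const (N := w) (fun k s' => s'.pos = k ∧
      s'.mem 13 0 = coinNumber ω k) _ (by decide) (by omega) ?_ ?_ ?_ (fun _ _ h => h.2)
    · intro s' h
      simp [h.mem 4 (by decide), h4]
    · simp [hpos, coinNumber]
    · rintro k s' hk h hv ⟨hI, hI'⟩
      have hlt : coinNumber ω (k + 1) < 2 ^ w :=
        (coinNumber_lt ω _).trans_le (Nat.pow_le_pow_right two_pos hk)
      refine Reaches.seq (Reaches.flip ?_ (Reaches.assign ?_ ?_))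
      · rcases L.eq_zero_or_pos with rfl | h
        · simp at hL
        · exact h
      · simp only [State.store_mem, Nat.reduceEqDiff, if_true, if_false, Expr.eval_add,
          Expr.eval_mul, Expr.eval_lit, Expr.eval_var, Function.update_self, hI, hI']
        exact hlt.trans hL
      · simp only [State.store_mem, State.store_pos, Nat.reduceEqDiff, if_true, if_false,
          Expr.eval_add, Expr.eval_mul, Expr.eval_lit, Expr.eval_var, Function.update_self, hI, hI']
        exact ⟨trivial, rfl⟩
  exact main.mono (by omega) fun _ _ h => h

/-- Evaluate the interpolant of the message at the random point; the result is in array `24`. -/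
def interpolateCmd : Cmd :=
  .assign 12 (.var 2) ;; weightsCmd ;; .assign 24 (.lit 0) ;;
  .for 8 (.var 2)
    (.assign 24 ((.var 24 + .get 15 (.var 8) * .get 19 (.var 8)) % .var 6))

theorem interpolateCmd_reaches {ω : ℕ → Bool} {L : ℕ} {s : State} {n d t : ℕ} {v : ℕ → ℕ → ℕ}
    {m : ℕ → ℕ} (hs : Ready n d v s) (h13 : s.mem 13 0 = t) (hN : 0 < n * d)
    (ht : t < modulus (n * d)) (hm : ∀ i < n * d, s.mem 19 i = m i)
    (hL : 32 * (n * d) + 32 ≤ 2 ^ L) :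
    Reaches ω L interpolateCmd s (10 * (n * d) + 10) fun s' =>
      s'.mem 24 0 < modulus (n * d) ∧ (s'.mem 24 0 : ZMod (modulus (n * d))) =
        ∑ i ∈ Finset.range (n * d),
          lagrangeCoeff (ZMod (modulus (n * d))) (n * d) (t : ZMod (modulus (n * d))) i * m i := by
  have hM := le_two_pow_coinCount (n * d)
  have hM' := two_pow_coinCount_lt hN
  have hpM := lt_modulus (n * d)
  have hp := modulus_le (n * d)
  set p := modulus (n * d) with hpdef
  have main : Reaches ω L interpolateCmd s
      (1 + ((7 * (n * d) + 6) + (1 + (n * d * (1 + 2) + 2)))) fun s' =>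
      s'.mem 24 0 < p ∧ (s'.mem 24 0 : ZMod p) =
        ∑ i ∈ Finset.range (n * d), lagrangeCoeff (ZMod p) (n * d) (t : ZMod p) i * m i := by
    refine Reaches.seq (Reaches.assign ?_ ?_)
    · simp only [Expr.eval_var, hs.size_eq]; omega
    refine Reaches.seq ((weightsCmd_reaches (p := p) (A := n * d) (t := t)
      (hs.table.congr (by simp) (by simp)) (by omega) (by simp [hs.size_eq]) (by simp [h13])
      hN (by omega) ht).mono le_rfl fun s₁ h₁ hl => ?_)
    have hs₁ : Ready n d v s₁ := (hs.store (by decide)).frame h₁ (by decide)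
    have h19 : s₁.mem 19 = s.mem 19 := by rw [h₁.mem 19 (by decide)]; simp
    refine Reaches.seq (Reaches.assign (by simp) ?_)
    refine Reaches.for_loop_const (N := n * d) (fun k s' =>
      s'.mem 24 0 < p ∧ (s'.mem 24 0 : ZMod p) =
        ∑ i ∈ Finset.range k, lagrangeCoeff (ZMod p) (n * d) (t : ZMod p) i * m i)
      _ (by decide) (by omega) ?_ ?_ ?_ (fun _ _ h => h)
    · intro s' h
      simp [h.mem 2 (by decide), hs₁.size_eq]
    · simp; omega
    · rintro k s' hk h hv ⟨hI, hI'⟩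
      have h6 : s'.mem 6 0 = p := by rw [h.mem 6 (by decide)]; simp [hs₁.table.prime, hpdef]
      have h15 : s'.mem 15 = s₁.mem 15 := by rw [h.mem 15 (by decide)]; simp
      have h19' : s'.mem 19 k = m k := by rw [h.mem 19 (by decide)]; simp [h19, hm k hk]
      refine Reaches.assign ?_ ?_
      · simp only [Expr.eval_mod, Expr.eval_var, h6]
        exact (Nat.mod_lt _ (by omega)).trans (by omega)
      · simp only [State.store_mem, Nat.reduceEqDiff, if_true, if_false, Function.update_self,
          Expr.eval_var, Expr.eval_mod, Expr.eval_add, Expr.eval_mul, Expr.eval_get, h6, hv, h19',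
          h15, ZMod.natCast_mod]
        refine ⟨Nat.mod_lt _ (by omega), ?_⟩
        rw [Nat.cast_add, hI', Nat.cast_mul, (hl k hk).2, Finset.sum_range_succ]
  exact main.mono (by omega) fun _ _ h => h

/-! ### The search for the first pair. -/

/-- Find the first row whose claimed number of partners is not `0`. -/
def findCmd : Cmd :=
  .assign 21 (.lit 0) ;; .assign 22 (.lit 0) ;;
  .for 8 (.get 0 (.lit 0))
    (.ite (.var 21) .skip
      (.ite (.get 19 (.var 8)) (.assign 21 (.lit 1) ;; .assign 22 (.var 8)) .skip))

theorem findCmd_reaches {ω : ℕ → Bool} {L : ℕ} {s : State} {n : ℕ} {m : ℕ → ℕ}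
    (hn : s.mem 0 0 = n) (hm : ∀ i < n, s.mem 19 i = m i) (hL : n + 1 < 2 ^ L) :
    Reaches ω L findCmd s (6 * n + 4) fun s' =>
      (s'.mem 21 0 = 0 ∧ ∀ i < n, m i = 0) ∨
      (s'.mem 21 0 = 1 ∧ s'.mem 22 0 < n ∧ m (s'.mem 22 0) ≠ 0 ∧ ∀ i < s'.mem 22 0, m i = 0) := by
  have main : Reaches ω L findCmd s (1 + (1 + (n * (4 + 2) + 2))) fun s' =>
      (s'.mem 21 0 = 0 ∧ ∀ i < n, m i = 0) ∨
      (s'.mem 21 0 = 1 ∧ s'.mem 22 0 < n ∧ m (s'.mem 22 0) ≠ 0 ∧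
        ∀ i < s'.mem 22 0, m i = 0) := by
    refine Reaches.seq (Reaches.assign (by simp) ?_)
    refine Reaches.seq (Reaches.assign (by simp) ?_)
    refine Reaches.for_loop_const (N := n) (fun k s' =>
      (s'.mem 21 0 = 0 ∧ ∀ i < k, m i = 0) ∨
      (s'.mem 21 0 = 1 ∧ s'.mem 22 0 < n ∧ m (s'.mem 22 0) ≠ 0 ∧
        ∀ i < s'.mem 22 0, m i = 0)) 4 (by decide) (by omega) ?_ ?_ ?_ (fun _ _ h => h)
    · intro s' h
      simp [h.mem 0 (by decide), hn]
    · simp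
    · rintro k s' hk h hv hI
      have h19 : s'.mem 19 k = m k := by rw [h.mem 19 (by decide)]; simp [hm k hk]
      refine Reaches.ite (k := 3) (fun he => ?_) (fun he => ?_)
      · simp only [Expr.eval_var] at he
        refine (Reaches.skip ?_).mono (by simp) fun _ _ h => h
        simp only [State.store_mem, Nat.reduceEqDiff, if_false]
        exact Or.inr (hI.resolve_left fun h => he h.1)
      · simp only [Expr.eval_var] at he
        have hI' : ∀ i < k, m i = 0 := (hI.resolve_right fun h => by omega).2
        refine Reaches.ite (k := 2) (fun he' => ?_) (fun he' => ?_)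
        · have he' : m k ≠ 0 := by simpa [hv, h19] using he'
          refine Reaches.seq (k₁ := 1) (k₂ := 1) (Reaches.assign ?_ (Reaches.assign ?_ ?_))
          · simp only [Expr.eval_lit]; omega
          · simp only [Expr.eval_var, State.store_mem, Nat.reduceEqDiff, if_false, hv]; omega
          · simp only [Expr.eval_var, Expr.eval_lit, State.store_mem, Nat.reduceEqDiff, if_false,
              if_true, hv, Function.update_self]
            exact Or.inr ⟨trivial, hk, he', hI'⟩
        · have he' : m k = 0 := by simpa [hv, h19] using he'
          refine (Reaches.skip ?_).mono (by simp) fun _ _ h => h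
          simp only [State.store_mem, Nat.reduceEqDiff, if_false]
          refine Or.inl ⟨he, fun i hi => ?_⟩
          rcases Nat.lt_succ_iff_lt_or_eq.1 hi with hi | rfl
          · exact hI' i hi
          · exact he'
  exact main.mono (by omega) fun _ _ h => h

/-- The inner product of rows `i` and `j`. -/
def dotProd (d : ℕ) (v : ℕ → ℕ → ℕ) (i j : ℕ) : ℕ := ∑ k ∈ Finset.range d, v i k * v j k

/-- Find the first partner of the row given in array `22`. -/
def scanCmd : Cmd :=
  .assign 25 (.lit 0) ;; .assign 23 (.lit 0) ;;
  .for 8 (.get 0 (.lit 0))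
    (.ite (.var 25) .skip
      (.ite (.eq (.var 8) (.var 22)) .skip
        (.assign 17 (.lit 0) ;;
          .for 9 (.get 0 (.lit 1))
            (.assign 17 (.var 17 + entryExpr (.var 22) (.var 9) * entryExpr (.var 8) (.var 9))) ;;
          .ite (.var 17) .skip (.assign 25 (.lit 1) ;; .assign 23 (.var 8)))))

/-- The scan reads the input rather than the message, so a pair that it finds is a solution whatever
the message claims. -/
theorem scanCmd_reaches {ω : ℕ → Bool} {L : ℕ} {s : State} {n d : ℕ} {v : ℕ → ℕ → ℕ}
    (hs : HasInput n d v s) (hv1 : ∀ i < n, ∀ k < d, v i k ≤ 1) (hi : s.mem 22 0 < n)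
    (hL : n + 1 < 2 ^ L) (hLd : d < 2 ^ L) :
    Reaches ω L scanCmd s (n * (3 * d + 10) + 4) fun s' =>
      (s'.mem 25 0 = 0 ∧ ∀ j < n, j ≠ s.mem 22 0 → dotProd d v (s.mem 22 0) j ≠ 0) ∨
      (s'.mem 25 0 = 1 ∧ s'.mem 23 0 < n ∧ s'.mem 23 0 ≠ s.mem 22 0 ∧
        dotProd d v (s.mem 22 0) (s'.mem 23 0) = 0 ∧
        ∀ j < s'.mem 23 0, j ≠ s.mem 22 0 → dotProd d v (s.mem 22 0) j ≠ 0) := by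
  have main : Reaches ω L scanCmd s
      (1 + (1 + (n * (((1 + ((d * (1 + 2) + 2) + (1 + 1 + 1))) + 1 + 1) + 2) + 2))) fun s' =>
      (s'.mem 25 0 = 0 ∧ ∀ j < n, j ≠ s.mem 22 0 → dotProd d v (s.mem 22 0) j ≠ 0) ∨
      (s'.mem 25 0 = 1 ∧ s'.mem 23 0 < n ∧ s'.mem 23 0 ≠ s.mem 22 0 ∧
        dotProd d v (s.mem 22 0) (s'.mem 23 0) = 0 ∧
        ∀ j < s'.mem 23 0, j ≠ s.mem 22 0 → dotProd d v (s.mem 22 0) j ≠ 0) := by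
    generalize hx : s.mem 22 0 = i at hi ⊢
    refine Reaches.seq (Reaches.assign (by simp) ?_)
    refine Reaches.seq (Reaches.assign (by simp) ?_)
    refine Reaches.for_loop_const (N := n) (fun k s' =>
      (s'.mem 25 0 = 0 ∧ ∀ j < k, j ≠ i → dotProd d v i j ≠ 0) ∨
      (s'.mem 25 0 = 1 ∧ s'.mem 23 0 < n ∧ s'.mem 23 0 ≠ i ∧ dotProd d v i (s'.mem 23 0) = 0 ∧
        ∀ j < s'.mem 23 0, j ≠ i → dotProd d v i j ≠ 0)) _ (by decide) (by omega) ?_ ?_ ?_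
      (fun _ _ h => h)
    · intro s' h
      simp [h.mem 0 (by decide), hs.n_eq]
    · simp
    · rintro k s' hk h hv hI
      have hs' : HasInput n d v s' := hs.congr (by rw [h.mem 0 (by decide)]; simp)
      have h22 : s'.mem 22 0 = i := by rw [h.mem 22 (by decide)]; simp [hx]
      refine Reaches.ite (fun he => ?_) (fun he => ?_)
      · simp only [Expr.eval_var] at he
        refine (Reaches.skip ?_).mono (by omega) fun _ _ h => h
        simp only [State.store_mem, Nat.reduceEqDiff, if_false]
        exact Or.inr (hI.resolve_left fun h => he h.1)
      · simp only [Expr.eval_var] at he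
        have hI' : ∀ j < k, j ≠ i → dotProd d v i j ≠ 0 := (hI.resolve_right fun h => by omega).2
        refine Reaches.ite (fun he' => ?_) (fun he' => ?_)
        · have he' : k = i := by
            by_contra hc; simp [hv, h22, hc] at he'
          refine (Reaches.skip ?_).mono (by omega) fun _ _ h => h
          simp only [State.store_mem, Nat.reduceEqDiff, if_false]
          exact Or.inl ⟨he, fun j hj hji => hI' j (by omega) hji⟩
        · have he' : k ≠ i := by
            rintro rfl; simp [hv, h22] at he'
          refine Reaches.seq (Reaches.assign (by simp) ?_)
          refine Reaches.seq (Reaches.for_loop_const (N := d) (fun l s'' =>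
            s''.mem 17 0 ≤ l ∧ s''.mem 17 0 = ∑ k' ∈ Finset.range l, v i k' * v k k')
            _ (by decide) hLd ?_ ?_ ?_ ?_)
          · intro s'' h'
            simp [h'.mem 0 (by decide), hs'.d_eq]
          · simp
          · rintro l s'' hl h' hv' ⟨hJ, hJ'⟩
            have hs'' : HasInput n d v s'' := hs'.congr (by rw [h'.mem 0 (by decide)]; simp)
            have h8 : s''.mem 8 0 = k := by rw [h'.mem 8 (by decide)]; simp [hv]
            have h22' : s''.mem 22 0 = i := by rw [h'.mem 22 (by decide)]; simp [h22]
            have hent := hs''.eval_entryExpr (e := .var 8) (f := .var 9) h8 hv' hk hl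
            have hent' := hs''.eval_entryExpr (e := .var 22) (f := .var 9) h22' hv' hi hl
            -- Entries are bits, so a partial inner product is at most its number of terms.
            have hle : v i l * v k l ≤ 1 := Nat.mul_le_mul (hv1 i hi l hl) (hv1 k hk l hl)
            refine Reaches.assign ?_ ?_
            · simp only [Expr.eval_add, Expr.eval_mul, Expr.eval_var, hent, hent']; omega
            · simp only [Expr.eval_add, Expr.eval_mul, Expr.eval_var, hent, hent',
                State.store_mem, Nat.reduceEqDiff, if_false, if_true, Function.update_self]
              exact ⟨by omega, by rw [Finset.sum_range_succ, hJ']⟩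
          · rintro s'' h' ⟨hJ, hJ'⟩
            have h8 : s''.mem 8 0 = k := by rw [h'.mem 8 (by decide)]; simp [hv]
            have h25 : s''.mem 25 0 = 0 := by rw [h'.mem 25 (by decide)]; simp [he]
            rw [← dotProd] at hJ'
            refine Reaches.ite (fun he'' => ?_) (fun he'' => ?_)
            · refine (Reaches.skip ?_).mono (by omega) fun _ _ h => h
              simp only [Expr.eval_var, hJ'] at he''
              simp only [State.store_mem, Nat.reduceEqDiff, if_false]
              refine Or.inl ⟨h25, fun j hj hji => ?_⟩
              rcases Nat.lt_succ_iff_lt_or_eq.1 hj with hj | rfl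
              · exact hI' j hj hji
              · exact he''
            · simp only [Expr.eval_var, hJ'] at he''
              refine Reaches.seq (Reaches.assign ?_ (Reaches.assign ?_ ?_))
              · simp only [Expr.eval_lit]; omega
              · simp only [Expr.eval_var, State.store_mem, Nat.reduceEqDiff, if_false, h8]; omega
              · simp only [Expr.eval_var, Expr.eval_lit, State.store_mem, Nat.reduceEqDiff,
                  if_false, if_true, h8, Function.update_self]
                exact Or.inr ⟨trivial, hk, he', he'', hI'⟩
  exact main.mono (by apply le_of_eq; ring) fun _ _ h => h

/-! ### The verifier assembled from its phases. -/

/-- The result of the verifier's search, when it trusts the claimed numbers of partners `m i`. -/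
def SearchResult (n d : ℕ) (v : ℕ → ℕ → ℕ) (m : ℕ → ℕ) (o : List ℕ) : Prop :=
  ((∀ i < n, m i = 0) ∧ o = []) ∨
  ∃ i < n, m i ≠ 0 ∧ (∀ i' < i, m i' = 0) ∧
    (((∀ j < n, j ≠ i → dotProd d v i j ≠ 0) ∧ o = []) ∨
    ∃ j < n, j ≠ i ∧ dotProd d v i j = 0 ∧ (∀ j' < j, j' ≠ i → dotProd d v i j' ≠ 0) ∧ o = [i, j])

/-- The verifier's test at the point `t` for the claimed values `m i`. -/
def Accepts (n d : ℕ) (v : ℕ → ℕ → ℕ) (m : ℕ → ℕ) (t : ℕ) : Prop :=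
  ∑ i ∈ Finset.range (n * d),
    lagrangeCoeff (ZMod (modulus (n * d))) (n * d) (t : ZMod (modulus (n * d))) i * m i =
  (countPoly (ZMod (modulus (n * d))) n d v).eval (t : ZMod (modulus (n * d)))

/-- The claimed numbers of partners, for a message in array `1`. -/
noncomputable def claimedCount (N : ℕ) (msg : ℕ → ℕ) (i : ℕ) : ℕ :=
  messageNumber msg (coinCount N) i % modulus N

/-- The verifier. -/
def verifierCmd : Cmd :=
  setupCmd ;; readCmd ;; drawCmd ;; interpolateCmd ;; evalCmd ;; findCmd ;;
  .ite (.var 21)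
    (scanCmd ;;
      .ite (.eq (.var 24) (.var 18))
        (.ite (.var 25) (.write (.var 22) ;; .write (.var 23)) .skip) .skip)
    .skip

/-- A pair is written only if the test accepts and the scan succeeds. If no claimed count is
nonzero, nothing is written in either case, which agrees with both clauses. -/
theorem verifierCmd_reaches {ω : ℕ → Bool} {L : ℕ} {s : State} {n d : ℕ} {v : ℕ → ℕ → ℕ}
    (hs : HasInput n d v s) (hv : ∀ i < n, ∀ k < d, v i k ≤ 1) (hm : ∀ i, s.mem 1 i ≤ 1)
    (h5 : ∀ c, s.mem 5 c = 0) (hpos : s.pos = 0) (hout : s.out = []) (hn : 0 < n) (hd : 0 < d)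
    (hL : 32 * (n * d) + 32 ≤ 2 ^ L) :
    Reaches ω L verifierCmd s (1000 * (n * d) * (Nat.log 2 (n * d) + 1)) fun s' =>
      (Accepts n d v (claimedCount (n * d) (s.mem 1)) (coinNumber ω (coinCount (n * d))) →
        SearchResult n d v (claimedCount (n * d) (s.mem 1)) s'.out) ∧
      (¬ Accepts n d v (claimedCount (n * d) (s.mem 1)) (coinNumber ω (coinCount (n * d))) →
        s'.out = []) := by
  have hN : 0 < n * d := Nat.mul_pos hn hd
  have hM := le_two_pow_coinCount (n * d)
  have hM' := two_pow_coinCount_lt hN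
  have hpM := lt_modulus (n * d)
  have hp := modulus_le (n * d)
  have hw := coinCount_le (n * d)
  have hnN : n ≤ n * d := Nat.le_mul_of_pos_right n hd
  have hdN : d ≤ n * d := Nat.le_mul_of_pos_left d hn
  have hr := coinNumber_lt ω (coinCount (n * d))
  generalize hmm : claimedCount (n * d) (s.mem 1) = m
  generalize hrr : coinNumber ω (coinCount (n * d)) = r at hr
  have main : Reaches ω L verifierCmd s (600 * (n * d) * (Nat.log 2 (n * d) + 1) +
      ((n * d * (4 * coinCount (n * d) + 11) + 2) + ((4 * coinCount (n * d) + 3) +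
      ((10 * (n * d) + 10) + (37 * (n * d) + ((6 * n + 4) +
      ((n * (3 * d + 10) + 4) + 4 + 1))))))) fun s' =>
      (Accepts n d v m r → SearchResult n d v m s'.out) ∧
      (¬ Accepts n d v m r → s'.out = []) := by
    refine Reaches.seq ((setupCmd_reaches hs h5 hN hL).mono le_rfl fun s₁ hf₁ h₁ => ?_)
    have hmsg : s₁.mem 1 = s.mem 1 := hf₁.mem 1 (by decide)
    refine Reaches.seq ((readCmd_reaches h₁ (by rwa [hmsg]) hN hL).mono le_rfl
      fun s₂ hf₂ hm₂ => ?_)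
    have h₂ : Ready n d v s₂ := h₁.frame hf₂ (by decide)
    rw [hmsg] at hm₂
    replace hm₂ : ∀ i < n * d, s₂.mem 19 i = m i := fun i hi => by rw [hm₂ i hi, ← hmm]; rfl
    refine Reaches.seq ((drawCmd_reaches h₂.coins_eq
      (by rw [hf₂.pos (by decide), hf₁.pos (by decide), hpos]) (by omega)).mono le_rfl
      fun s₃ hf₃ h13 => ?_)
    have h₃ : Ready n d v s₃ := h₂.frame hf₃ (by decide)
    rw [hrr] at h13
    refine Reaches.seq ((interpolateCmd_reaches (m := m) h₃ h13 hN (by omega)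
      (by rwa [hf₃.mem 19 (by decide)]) hL).mono le_rfl ?_)
    rintro s₄ hf₄ ⟨h24, h24'⟩
    have h₄ : Ready n d v s₄ := h₃.frame hf₄ (by decide)
    refine Reaches.seq ((evalCmd_reaches (p := modulus (n * d)) (t := r) h₄.table h₄.input
      (by omega) (by omega) (by rw [hf₄.mem 13 (by decide), h13]) hn hd (by omega)
      (by omega)).mono le_rfl ?_)
    rintro s₅ hf₅ ⟨h18, h18'⟩
    have h₅ : Ready n d v s₅ := h₄.frame hf₅ (by decide)
    have h19 : s₅.mem 19 = s₂.mem 19 := by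
      rw [hf₅.mem 19 (by decide), hf₄.mem 19 (by decide), hf₃.mem 19 (by decide)]
    refine Reaches.seq ((findCmd_reaches (m := m) h₅.input.n_eq
      (by rw [h19]; exact fun i hi => hm₂ i (by omega)) (by omega)).mono le_rfl
      fun s₆ hf₆ hfind => ?_)
    have h₆ : Ready n d v s₆ := h₅.frame hf₆ (by decide)
    have hout₆ : s₆.out = [] := by
      rw [hf₆.out (by decide), hf₅.out (by decide), hf₄.out (by decide), hf₃.out (by decide),
        hf₂.out (by decide), hf₁.out (by decide), hout]
    refine Reaches.ite (fun he => ?_) (fun he => ?_)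
    · simp only [Expr.eval_var] at he
      obtain ⟨-, hi, hmi, hlt⟩ := hfind.resolve_left fun h => he h.1
      refine Reaches.seq (k₁ := n * (3 * d + 10) + 4) (k₂ := 4) ((scanCmd_reaches h₆.input hv hi (by omega) (by omega)).mono le_rfl
        fun s₇ hf₇ hscan => ?_)
      -- Both numbers are reduced residues, so comparing them as integers decides equality in the
      -- field.
      have hacc : s₇.mem 24 0 = s₇.mem 18 0 ↔ Accepts n d v m r := by
        have e24 : s₇.mem 24 0 = s₄.mem 24 0 := by
          rw [hf₇.mem 24 (by decide), hf₆.mem 24 (by decide), hf₅.mem 24 (by decide)]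
        have e18 : s₇.mem 18 0 = s₅.mem 18 0 := by
          rw [hf₇.mem 18 (by decide), hf₆.mem 18 (by decide)]
        rw [Accepts, ← h24', ← h18', e24, e18, ZMod.natCast_eq_natCast_iff, Nat.ModEq,
          Nat.mod_eq_of_lt h24, Nat.mod_eq_of_lt h18]
      have hout₇ : s₇.out = [] := by rw [hf₇.out (by decide), hout₆]
      have h22 : s₇.mem 22 0 = s₆.mem 22 0 := by rw [hf₇.mem 22 (by decide)]
      refine Reaches.ite (k := 3) (fun hc => ?_) (fun hc => ?_)
      · have hc : Accepts n d v m r := by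
          rw [← hacc]; by_contra h; simp [h] at hc
        refine Reaches.ite (k := 2) (fun hc' => ?_) (fun hc' => ?_)
        · simp only [Expr.eval_var] at hc'
          obtain ⟨-, hj, hji, hdot, hj'⟩ := hscan.resolve_left fun h => hc' h.1
          refine Reaches.seq (k₁ := 1) (k₂ := 1) (Reaches.write (Reaches.write ⟨fun _ => ?_, fun h => absurd hc h⟩))
          exact Or.inr ⟨_, hi, hmi, hlt, Or.inr ⟨_, hj, hji, hdot, hj', by simp [hout₇, h22]⟩⟩
        · simp only [Expr.eval_var] at hc'
          have hno := (hscan.resolve_right fun h => by omega).2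
          refine (Reaches.skip ⟨fun _ => ?_, fun h => absurd hc h⟩).mono (by omega) fun _ _ h => h
          exact Or.inr ⟨_, hi, hmi, hlt, Or.inl ⟨hno, hout₇⟩⟩
      · have hc : ¬ Accepts n d v m r := by
          rw [← hacc]; intro h; simp [h] at hc
        exact (Reaches.skip ⟨fun h => absurd h hc, fun _ => hout₇⟩).mono (by omega) fun _ _ h => h
    · simp only [Expr.eval_var] at he
      have hno := (hfind.resolve_right fun h => by omega).2
      exact (Reaches.skip ⟨fun _ => Or.inl ⟨hno, hout₆⟩, fun _ => hout₆⟩).mono (by omega)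
        fun _ _ h => h
  refine main.mono ?_ fun _ _ h => h
  have key : ∀ N l w : ℕ, 0 < N → w ≤ l + 3 → n ≤ N → n * d = N → 600 * N * (l + 1) +
      ((N * (4 * w + 11) + 2) + ((4 * w + 3) + ((10 * N + 10) + (37 * N + ((6 * n + 4) +
      ((n * (3 * d + 10) + 4) + 4 + 1)))))) ≤ 1000 * N * (l + 1) := by
    intro N l w hN hw hn hnd
    have h1 : N * w ≤ N * (l + 3) := Nat.mul_le_mul_left _ hw
    have h2 : l ≤ N * l := Nat.le_mul_of_pos_left l hN
    nlinarith
  exact key _ _ _ hN hw hnN rfl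

/-! ## Coin tosses -/

instance : IsProbabilityMeasure coins := by
  unfold coins; infer_instance

theorem coinNumber_injective {ω ω' : ℕ → Bool} {w : ℕ} (h : coinNumber ω w = coinNumber ω' w) :
    ∀ i < w, ω i = ω' i := by
  induction w with
  | zero => simp
  | succ w ih =>
    have h1 := (ω w).toNat_le
    have h2 := (ω' w).toNat_le
    simp only [coinNumber] at h
    intro i hi
    rcases Nat.lt_succ_iff_lt_or_eq.1 hi with hi | rfl
    · exact ih (by omega) i hi
    · have h3 : (ω i).toNat = (ω' i).toNat := by omega
      revert h3
      cases ω i <;> cases ω' i <;> simp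

/-- A value of `coinNumber` fixes the first `w` coins, so the event lies in a cylinder of measure `2
^ (-w)`. The inclusion suffices, and no measurability of the event is needed. -/
theorem coins_coinNumber_eq_le (w r : ℕ) : coins {ω | coinNumber ω w = r} ≤ (2 ^ w)⁻¹ := by
  rcases Set.eq_empty_or_nonempty {ω | coinNumber ω w = r} with h | ⟨ω₀, h₀⟩
  · simp [h]
  have hsub : {ω | coinNumber ω w = r} ⊆
      Set.pi (Finset.range w : Set ℕ) fun i => ({ω₀ i} : Set Bool) := by
    intro ω hω i hi
    exact coinNumber_injective (Eq.trans hω (Eq.symm h₀)) i (Finset.mem_range.1 hi)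
  refine (measure_mono hsub).trans ?_
  rw [coins, Measure.infinitePi_pi _ (fun i _ => MeasurableSet.singleton _)]
  simp [ENNReal.inv_pow]

/-- The bad values have probability at most `1/4`, hence at most `1/3`. Subadditivity of the outer
measure replaces passing to complements, so `A` need not be measurable. -/
theorem two_thirds_le_coins {w : ℕ} (S : Finset ℕ) (hS : 4 * S.card ≤ 2 ^ w) {A : Set (ℕ → Bool)}
    (hA : ∀ ω, coinNumber ω w ∉ S → ω ∈ A) : 2 / 3 ≤ coins A := by
  have h1 : coins {ω | coinNumber ω w ∈ S} ≤ 1 / 3 := by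
    have hU : {ω | coinNumber ω w ∈ S} = ⋃ r ∈ S, {ω | coinNumber ω w = r} := by ext; simp
    calc coins {ω | coinNumber ω w ∈ S} ≤ ∑ r ∈ S, coins {ω | coinNumber ω w = r} := by
          rw [hU]; exact measure_biUnion_finset_le _ _
      _ ≤ ∑ _r ∈ S, ((2 : ℝ≥0∞) ^ w)⁻¹ := Finset.sum_le_sum fun r _ => coins_coinNumber_eq_le w r
      _ = (S.card : ℝ≥0∞) / 2 ^ w := by simp [div_eq_mul_inv]
      _ ≤ 1 / 3 := by
        refine ENNReal.div_le_of_le_mul ?_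
        rw [one_div, ← ENNReal.div_eq_inv_mul, ENNReal.le_div_iff_mul_le (by simp) (by simp)]
        exact_mod_cast (by omega : S.card * 3 ≤ 2 ^ w)
  have h2 : (1 : ℝ≥0∞) ≤ coins {ω | coinNumber ω w ∈ S} + coins A := by
    rw [← measure_univ (μ := coins)]
    refine (measure_mono fun ω _ => ?_).trans (measure_union_le _ _)
    by_cases h : coinNumber ω w ∈ S
    · exact Or.inl h
    · exact Or.inr (hA ω h)
  have h3 : (1 : ℝ≥0∞) ≤ 1 / 3 + coins A := h2.trans (add_le_add_left h1 _)
  have h4 : (1 : ℝ≥0∞) = 1 / 3 + 2 / 3 := by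
    rw [ENNReal.div_add_div_same, one_add_one_eq_two.symm, ← add_assoc]
    norm_num
    exact (ENNReal.div_self (by simp) (by simp)).symm
  exact (ENNReal.add_le_add_iff_left (a := 1 / 3) (by simp)).1 (h4.ge.trans h3)

/-! ## Instances of Orthogonal Vectors -/

namespace OVInstance

variable (x : OVInstance)

/-- The `k`-th bit of the `i`-th vector (`0` outside the range). -/
def entry (i k : ℕ) : ℕ :=
  if h : i < x.n ∧ k < x.d then (x.vec ⟨i, h.1⟩ ⟨k, h.2⟩).toNat else 0

theorem entry_le_one (i k : ℕ) : x.entry i k ≤ 1 := by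
  unfold entry; split_ifs
  · exact Bool.toNat_le _
  · exact zero_le_one

theorem inner_eq (i j : Fin x.n) : x.inner i j = dotProd x.d x.entry i j := by
  rw [dotProd, Finset.sum_range]
  simp [inner, entry]

theorem orthogonalVectors_iff {i j : ℕ} : OrthogonalVectors x (toLex (i, j)) ↔
    i < x.n ∧ j < x.n ∧ i ≠ j ∧ dotProd x.d x.entry i j = 0 := by
  constructor
  · rintro ⟨i', j', hne, h0, h⟩
    obtain ⟨rfl, rfl⟩ := Prod.mk.inj (toLex.injective h)
    exact ⟨i'.2, j'.2, fun h => hne (Fin.ext h), by rwa [← inner_eq]⟩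
  · rintro ⟨hi, hj, hne, h0⟩
    exact ⟨⟨i, hi⟩, ⟨j, hj⟩, fun h => hne (congrArg Fin.val h), by rwa [inner_eq], rfl⟩

theorem hasInput_initState (msg : List Bool) :
    HasInput x.n x.d x.entry (initState x.encode msg) := by
  refine ⟨rfl, rfl, fun i hi k hk => ?_⟩
  have hlt : i * x.d + k < x.n * x.d := by
    have := Nat.mul_le_mul_right x.d hi
    rw [Nat.succ_mul] at this
    omega
  have h1 : (i * x.d + k) / x.d = i := by
    rw [mul_comm, Nat.mul_add_div x.d_pos, Nat.div_eq_of_lt hk, add_zero]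
  have h2 : (i * x.d + k) % x.d = k := by
    rw [mul_comm, Nat.mul_add_mod, Nat.mod_eq_of_lt hk]
  simp only [initState, encode, if_true]
  rw [show 2 + i * x.d + k = i * x.d + k + 1 + 1 by ring, List.getD_cons_succ,
    List.getD_cons_succ, List.getD_eq_getElem _ _ (by simpa using hlt), List.getElem_ofFn, entry,
    dif_pos ⟨hi, hk⟩]
  congr 2 <;> exact Fin.ext (by simp [h1, h2])

/-- Fixes the word length used throughout: loop bounds, the modulus and the numbers read from the
message are linear in `n * d`. -/
theorem two_pow_bound : 32 * (x.n * x.d) + 32 ≤ 2 ^ (Nat.log 2 (x.n * x.d) + 6) := by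
  have := Nat.lt_pow_succ_log_self one_lt_two (x.n * x.d)
  have h : 2 ^ (Nat.log 2 (x.n * x.d) + 6) = 32 * 2 ^ (Nat.log 2 (x.n * x.d) + 1) := by ring
  simp only [Nat.succ_eq_add_one] at this
  omega

theorem initState_msg_le_one (l : List ℕ) (msg : List Bool) (i : ℕ) :
    (initState l msg).mem 1 i ≤ 1 := by
  simpa [initState] using Bool.toNat_le _

theorem bounded_initState (msg : List Bool) :
    Bounded (Nat.log 2 (x.n * x.d) + 6) (initState x.encode msg).mem := by
  have hb := x.two_pow_bound
  have hn : x.n ≤ x.n * x.d := Nat.le_mul_of_pos_right _ x.d_pos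
  have hd : x.d ≤ x.n * x.d := Nat.le_mul_of_pos_left _ x.n_pos
  intro a i
  rcases a with _ | _ | a
  · have : ∀ y ∈ x.encode, y ≤ x.n * x.d + 1 := by
      simp only [encode, List.mem_cons, List.mem_ofFn]
      rintro y (rfl | rfl | ⟨k, rfl⟩)
      · omega
      · omega
      · exact (Bool.toNat_le _).trans (by omega)
    have h : (initState x.encode msg).mem 0 i ≤ x.n * x.d + 1 := by
      simp only [initState, if_true]
      rcases lt_or_ge i x.encode.length with h | h
      · rw [List.getD_eq_getElem _ _ h]; exact this _ (List.getElem_mem h)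
      · rw [List.getD_eq_default _ _ h]; omega
    exact h.trans_lt (by omega)
  · have := initState_msg_le_one x.encode msg i
    simp only [zero_add]
    omega
  · simp [initState]

end OVInstance

/-! ## The claimed and the true numbers of partners -/

/-- The count is at most `n`, hence below the modulus, so it cannot vanish modulo the prime without
being zero. The row `j = i` is counted too. -/
theorem countPoly_eval_ne_zero_iff {n d i : ℕ} {v : ℕ → ℕ → ℕ} (hd : 0 < d)
    (hv : ∀ i < n, ∀ k < d, v i k ≤ 1) (hi : i < n) :
    (countPoly (ZMod (modulus (n * d))) n d v).eval (i : ZMod (modulus (n * d))) ≠ 0 ↔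
      ∃ j < n, dotProd d v i j = 0 := by
  have hnN : n ≤ n * d := Nat.le_mul_of_pos_right n hd
  have hM := le_two_pow_coinCount (n * d)
  have hpM := lt_modulus (n * d)
  have hinj : Set.InjOn (fun j : ℕ => (j : ZMod (modulus (n * d)))) (Finset.range n) :=
    ZMod.injOn_natCast _ fun j hj => by
      have : j < n := by simpa using hj
      omega
  rw [eval_countPoly_natCast hinj hv hi, Ne, ZMod.natCast_eq_zero_iff]
  set S := Finset.filter (fun j => ∀ k < d, v i k * v j k = 0) (Finset.range n) with hS
  have hcard : S.card ≤ n := (Finset.card_filter_le _ _).trans (by simp)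
  have hdvd : modulus (n * d) ∣ S.card ↔ S = ∅ := by
    rw [← Finset.card_eq_zero]
    exact ⟨fun h => Nat.eq_zero_of_dvd_of_lt h (by omega), fun h => by simp [h]⟩
  rw [hdvd, ← Ne, ← Finset.nonempty_iff_ne_empty]
  simp only [Finset.Nonempty, hS, Finset.mem_filter, Finset.mem_range, dotProd,
    Finset.sum_eq_zero_iff]

/-- The claimed values are the true ones. -/
def Truthful (n d : ℕ) (v : ℕ → ℕ → ℕ) (m : ℕ → ℕ) : Prop :=
  ∀ i < n * d, (m i : ZMod (modulus (n * d))) =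
    (countPoly (ZMod (modulus (n * d))) n d v).eval (i : ZMod (modulus (n * d)))

theorem injOn_natCast_modulus {N : ℕ} (S : Finset ℕ) (h : ∀ i ∈ S, i < 2 ^ coinCount N) :
    Set.InjOn (fun j : ℕ => (j : ZMod (modulus N))) S :=
  ZMod.injOn_natCast _ fun j hj => (h j hj).trans (lt_modulus N)

theorem lt_two_pow_coinCount {N i : ℕ} (hi : i ∈ Finset.range N) : i < 2 ^ coinCount N := by
  have := le_two_pow_coinCount N
  have := Finset.mem_range.1 hi
  omega

theorem Truthful.accepts {n d : ℕ} {v : ℕ → ℕ → ℕ} {m : ℕ → ℕ} (h : Truthful n d v m) (hn : 0 < n)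
    (hd : 0 < d) (t : ℕ) : Accepts n d v m t := by
  rw [Accepts, ← eval_interpolate_eq_sum, interpolate_eq_countPoly hn hd
    (injOn_natCast_modulus _ fun i hi => lt_two_pow_coinCount hi) h]

open Classical in
-- Test points lie below `2 ^ coinCount (n * d)`, which is below the modulus, so distinct accepted
-- points are distinct field elements.
theorem truthful_of_accepts {n d : ℕ} {v : ℕ → ℕ → ℕ} {m : ℕ → ℕ} (hn : 0 < n) (hd : 0 < d)
    (h : n * d ≤ ((Finset.range (2 ^ coinCount (n * d))).filter (Accepts n d v m)).card) :
    Truthful n d v m := fun _ hi =>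
  eval_eq_of_card_le hn hd (injOn_natCast_modulus _ fun _ hi => lt_two_pow_coinCount hi)
    (r := fun i => (m i : ZMod (modulus (n * d))))
    (injOn_natCast_modulus _ fun _ hi => Finset.mem_range.1 (Finset.mem_filter.1 hi).1) h
    (fun _ ht => (Finset.mem_filter.1 ht).2) hi

theorem Truthful.ne_zero_iff {n d i : ℕ} {v : ℕ → ℕ → ℕ} {m : ℕ → ℕ} (h : Truthful n d v m)
    (hd : 0 < d) (hv : ∀ i < n, ∀ k < d, v i k ≤ 1)
    (hm : ∀ i, m i < modulus (n * d)) (hi : i < n) :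
    m i ≠ 0 ↔ ∃ j < n, dotProd d v i j = 0 := by
  rw [← countPoly_eval_ne_zero_iff hd hv hi,
    ← h i (hi.trans_le (Nat.le_mul_of_pos_right n hd)), Ne, Ne, ZMod.natCast_eq_zero_iff]
  exact not_congr ⟨fun h => by simp [h], fun h => Nat.eq_zero_of_dvd_of_lt h (hm i)⟩

theorem claimedCount_lt (N : ℕ) (msg : ℕ → ℕ) (i : ℕ) : claimedCount N msg i < modulus N :=
  Nat.mod_lt _ (Fact.out : (modulus N).Prime).pos

theorem sum_two_pow_mul_bit (x k : ℕ) : ∑ b ∈ Finset.range k, 2 ^ b * (x / 2 ^ b % 2) = x % 2 ^ k := by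
  induction k with
  | zero => simp [Nat.mod_one]
  | succ k ih => rw [Finset.sum_range_succ, ih, Nat.mod_pow_succ]

/-- The modulus is at most twice `2 ^ coinCount (n * d)`, so `coinCount (n * d) + 1` bits hold each
value and the blocks are decoded without loss. -/
theorem truthful_of_honest {n d : ℕ} {v : ℕ → ℕ → ℕ} {msg : ℕ → ℕ}
    (h : ∀ i < n * d * (coinCount (n * d) + 1), msg i = messageBit n d v i) :
    Truthful n d v (claimedCount (n * d) msg) := by
  intro i hi
  have h1 : messageNumber msg (coinCount (n * d)) i = countValue n d v i := by
    have h2 : countValue n d v i < 2 ^ (coinCount (n * d) + 1) := by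
      rw [pow_succ']
      exact (ZMod.val_lt _).trans_le (modulus_le _)
    rw [← Nat.mod_eq_of_lt h2, ← sum_two_pow_mul_bit]
    refine Finset.sum_congr rfl fun b hb => ?_
    have hb := Finset.mem_range.1 hb
    have hlt : i * (coinCount (n * d) + 1) + b < n * d * (coinCount (n * d) + 1) := by
      have := Nat.mul_le_mul_right (coinCount (n * d) + 1) hi
      rw [Nat.succ_mul] at this
      omega
    rw [h _ hlt, messageBit, mul_comm i, Nat.mul_add_div (by omega), Nat.mul_add_mod,
      Nat.div_eq_of_lt hb, Nat.mod_eq_of_lt hb, add_zero]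
  rw [claimedCount, h1, ZMod.natCast_mod, countValue, ZMod.natCast_zmod_val]

/-! ## The canonical solution -/

/-- The lexicographically first solution (`(0, 0)` if there is none). -/
noncomputable def canonicalPair (x : OVInstance) : ℕ ×ₗ ℕ :=
  open Classical in
  if h : ∃ y, OrthogonalVectors x y then
    WellFounded.min (wellFounded_lt (α := ℕ ×ₗ ℕ)) {y | OrthogonalVectors x y} h
  else toLex (0, 0)

theorem isLeast_canonicalPair {x : OVInstance} (h : ∃ y, OrthogonalVectors x y) :
    IsLeast {y | OrthogonalVectors x y} (canonicalPair x) := by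
  rw [canonicalPair, dif_pos h]
  exact ⟨WellFounded.min_mem _ _ h, fun y hy => not_lt.1 (WellFounded.not_lt_min _ _ hy)⟩

theorem dotProd_eq_zero_of_self {d i j : ℕ} {v : ℕ → ℕ → ℕ} (h : dotProd d v i i = 0) :
    dotProd d v i j = 0 := by
  rw [dotProd, Finset.sum_eq_zero_iff] at h ⊢
  intro k hk
  rw [mul_self_eq_zero.1 (h k hk), zero_mul]

/-- The row `a` of the first solution has nonzero count, so the row `i` that is found satisfies `i ≤
a`; if `i` has a partner, minimality of the solution gives `i = a`. -/
theorem SearchResult.decodePair_eq {x : OVInstance} {m : ℕ → ℕ} {o : List ℕ}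
    (hx : ∃ y, OrthogonalVectors x y) (hm : ∀ i < x.n, m i ≠ 0 ↔
      ∃ j < x.n, dotProd x.d x.entry i j = 0) (h : SearchResult x.n x.d x.entry m o) :
    decodePair o = some (canonicalPair x) := by
  obtain ⟨hc, hleast⟩ := isLeast_canonicalPair hx
  generalize canonicalPair x = c at hc hleast
  obtain ⟨⟨a, b⟩, rfl⟩ := toLex.surjective c
  obtain ⟨ha, hb, hab, hdot⟩ := x.orthogonalVectors_iff.1 hc
  have hma : m a ≠ 0 := (hm a ha).2 ⟨b, hb, hdot⟩
  rcases h with ⟨h0, -⟩ | ⟨i, hi, hmi, hlt, h⟩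
  · exact absurd (h0 a ha) hma
  have hia : i ≤ a := by
    by_contra hc
    exact hma (hlt a (not_le.1 hc))
  rcases h with ⟨hno, -⟩ | ⟨j, hj, hji, hij, hfirst, rfl⟩
  · exfalso
    obtain ⟨j, hj, hij⟩ := (hm i hi).1 hmi
    -- If the only known orthogonal row is the row itself, that row is zero. Then `a` or `b`,
    -- whichever differs from it, is a partner, against the failed scan.
    by_cases hji : j = i
    · subst hji
      by_cases haj : a = j
      · exact hno b hb (fun h => hab (haj.trans h.symm)) (dotProd_eq_zero_of_self hij)
      · exact hno a ha haj (dotProd_eq_zero_of_self hij)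
    · exact hno j hj hji hij
  -- Minimality of `(a, b)` yields `a = i` and `b ≤ j`; the scan rejected every earlier partner, so
  -- `b < j` is impossible.
  · have hle : toLex (a, b) ≤ toLex (i, j) :=
      hleast (x.orthogonalVectors_iff.2 ⟨hi, hj, hji.symm, hij⟩)
    rw [Prod.Lex.toLex_le_toLex] at hle
    have hai : a = i := by rcases hle with h | h <;> (simp at h; omega)
    subst hai
    have hbj : b ≤ j := by rcases hle with h | h <;> simp at h; omega
    have : b = j := by
      by_contra hne
      exact hfirst b (by omega) hab.symm hdot
    rw [this]; rfl

theorem SearchResult.orthogonalVectors {x : OVInstance} {m : ℕ → ℕ} {o : List ℕ}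
    (h : SearchResult x.n x.d x.entry m o) (ho : decodePair o ≠ none) :
    ∃ y, OrthogonalVectors x y := by
  rcases h with ⟨-, rfl⟩ | ⟨i, hi, -, -, ⟨-, rfl⟩ | ⟨j, hj, hji, hij, -, rfl⟩⟩
  · exact absurd rfl ho
  · exact absurd rfl ho
  · exact ⟨_, x.orthogonalVectors_iff.2 ⟨hi, hj, hji.symm, hij⟩⟩

/-! ## The theorem -/

/-- The running time of the verifier. -/
noncomputable def verifierTime (x : OVInstance) : ℕ :=
  verifierCmd.weight * (Nat.log 2 (x.n * x.d) + 6 + 1) ^ 2 *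
    (1000 * (x.n * x.d) * (Nat.log 2 (x.n * x.d) + 1))

/-- The running time of the prover. -/
noncomputable def proverTime (x : OVInstance) : ℕ :=
  proverCmd.weight * (Nat.log 2 (x.n * x.d) + 6 + 1) ^ 2 *
    (1000 * (x.n * x.d) ^ 2 * (Nat.log 2 (x.n * x.d) + 1))

theorem time_le (W f l : ℕ) : W * (l + 6 + 1) ^ 2 * (1000 * f * (l + 1)) ≤
    W * 49000 * f * (l + 1) ^ 3 := by
  calc W * (l + 6 + 1) ^ 2 * (1000 * f * (l + 1))
      ≤ W * (7 * (l + 1)) ^ 2 * (1000 * f * (l + 1)) := by gcongr; omega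
    _ = W * 49000 * f * (l + 1) ^ 3 := by ring

theorem verifierTime_mem : verifierTime ∈ SoftO fun x : OVInstance => x.n * x.d :=
  ⟨verifierCmd.weight * 49000, 3, fun _ => time_le _ _ _⟩

theorem proverTime_mem : proverTime ∈ SoftO fun x : OVInstance => x.n ^ 2 * x.d ^ 2 := by
  refine ⟨proverCmd.weight * 49000, 3, fun x => (time_le _ _ _).trans ?_⟩
  simp only [← mul_pow]
  gcongr
  exact Nat.le_self_pow two_ne_zero _

theorem verifier_run (x : OVInstance) (msg : List Bool) (ω : ℕ → Bool) :
    ∃ s t, Exec ω verifierCmd (initState x.encode msg) s t ∧ t ≤ verifierTime x ∧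
      (Accepts x.n x.d x.entry (claimedCount (x.n * x.d) ((initState x.encode msg).mem 1))
          (coinNumber ω (coinCount (x.n * x.d))) →
        SearchResult x.n x.d x.entry
          (claimedCount (x.n * x.d) ((initState x.encode msg).mem 1)) s.out) ∧
      (¬ Accepts x.n x.d x.entry (claimedCount (x.n * x.d) ((initState x.encode msg).mem 1))
          (coinNumber ω (coinCount (x.n * x.d))) → s.out = []) := by
  obtain ⟨s, t, he, ht, -, hs⟩ := verifierCmd_reaches (ω := ω) (x.hasInput_initState msg)
    (fun i _ k _ => x.entry_le_one i k) (OVInstance.initState_msg_le_one _ msg) (fun _ => rfl) rfl rfl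
    x.n_pos x.d_pos x.two_pow_bound (x.bounded_initState msg)
  exact ⟨s, t, he, ht, hs⟩

theorem prover_run (x : OVInstance) (ω : ℕ → Bool) :
    ∃ s t, Exec ω proverCmd (initState x.encode []) s t ∧ t ≤ proverTime x ∧
      s.out = (List.range (x.n * x.d * (coinCount (x.n * x.d) + 1))).map
        (messageBit x.n x.d x.entry) := by
  obtain ⟨s, t, he, ht, -, hs⟩ := proverCmd_reaches (ω := ω) (x.hasInput_initState [])
    (fun _ => rfl) rfl x.n_pos x.d_pos x.two_pow_bound (x.bounded_initState [])
  exact ⟨s, t, he, ht, hs⟩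

theorem initState_honest (x : OVInstance) {i : ℕ}
    (hi : i < x.n * x.d * (coinCount (x.n * x.d) + 1)) :
    (initState x.encode (toMessage ((List.range (x.n * x.d * (coinCount (x.n * x.d) + 1))).map
      (messageBit x.n x.d x.entry)))).mem 1 i = messageBit x.n x.d x.entry i := by
  have h1 : ∀ k, k < 2 → (decide (k ≠ 0)).toNat = k := by decide
  have h2 : messageBit x.n x.d x.entry i < 2 := Nat.mod_lt _ two_pos
  simp only [initState, toMessage, one_ne_zero, if_false, if_true]
  rw [List.getD_eq_getElem _ _ (by simpa using hi)]
  simpa using h1 _ h2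

theorem Truthful.decodePair_eq {x : OVInstance} {msg : ℕ → ℕ} {o : List ℕ}
    (h : Truthful x.n x.d x.entry (claimedCount (x.n * x.d) msg))
    (hx : ∃ y, OrthogonalVectors x y)
    (ho : SearchResult x.n x.d x.entry (claimedCount (x.n * x.d) msg) o) :
    decodePair o = some (canonicalPair x) :=
  ho.decodePair_eq hx fun _ hi => h.ne_zero_iff x.d_pos
    (fun i _ k _ => x.entry_le_one i k) (claimedCount_lt _ _) hi

/-- Equal polynomials agree at every point, so the honest message is accepted for all coins and the
success probability is `1`. -/
theorem canonical_completeness (x : OVInstance) (hx : ∃ y, OrthogonalVectors x y)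
    (ω : (ℕ → Bool) × (ℕ → Bool)) : ∃ z o, Outputs ω.1 proverCmd x.encode [] z ∧
      Outputs ω.2 verifierCmd x.encode (toMessage z) o ∧ decodePair o = some (canonicalPair x) := by
  obtain ⟨s, t, he, -, hs⟩ := prover_run x ω.1
  obtain ⟨s', t', he', -, hacc, -⟩ := verifier_run x (toMessage s.out) ω.2
  have htrue : Truthful x.n x.d x.entry (claimedCount (x.n * x.d)
      ((initState x.encode (toMessage s.out)).mem 1)) :=
    truthful_of_honest fun i hi => by rw [hs]; exact initState_honest x hi
  exact ⟨_, _, ⟨s, t, he, rfl⟩, ⟨s', t', he', rfl⟩,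
    htrue.decodePair_eq hx (hacc (htrue.accepts x.n_pos x.d_pos _))⟩

theorem canonical_soundness (x : OVInstance) (hx : ∃ y, OrthogonalVectors x y) (msg : List Bool) :
    2 / 3 ≤ coins {ω | ∃ o, Outputs ω verifierCmd x.encode msg o ∧
      (decodePair o = some (canonicalPair x) ∨ decodePair o = none)} := by
  classical
  set m := claimedCount (x.n * x.d) ((initState x.encode msg).mem 1) with hm
  by_cases htrue : Truthful x.n x.d x.entry m
  -- Truthful messages have no bad coins, so the empty set of bad values serves.
  · refine two_thirds_le_coins (w := 0) ∅ (by simp) fun ω _ => ?_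
    obtain ⟨s, t, he, -, hacc, -⟩ := verifier_run x msg ω
    exact ⟨_, ⟨s, t, he, rfl⟩,
      Or.inl (htrue.decodePair_eq hx (hacc (htrue.accepts x.n_pos x.d_pos _)))⟩
  · refine two_thirds_le_coins (w := coinCount (x.n * x.d))
      ((Finset.range (2 ^ coinCount (x.n * x.d))).filter (Accepts x.n x.d x.entry m)) ?_
      fun ω hω => ?_
    -- An untruthful message is accepted at fewer than `n * d` of at least `4 * (n * d)` test
    -- points.
    · have h1 := mt (truthful_of_accepts x.n_pos x.d_pos) htrue
      have h2 := le_two_pow_coinCount (x.n * x.d)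
      omega
    · obtain ⟨s, t, he, -, -, hrej⟩ := verifier_run x msg ω
      refine ⟨_, ⟨s, t, he, rfl⟩, Or.inr ?_⟩
      rw [hrej fun h => hω (Finset.mem_filter.2 ⟨Finset.mem_range.2 (coinNumber_lt _ _), h⟩)]
      rfl

/-- Uniqueness of runs transfers the specification to the given run: the output is either empty or a
pair whose inner product was checked. -/
theorem standard_soundness (x : OVInstance) (hx : ¬ ∃ y, OrthogonalVectors x y) (msg : List Bool)
    (ω : ℕ → Bool) : ¬ ∃ o, Outputs ω verifierCmd x.encode msg o ∧ decodePair o ≠ none := by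
  rintro ⟨o, ⟨s', t', he', rfl⟩, ho⟩
  obtain ⟨s, t, he, -, hacc, hrej⟩ := verifier_run x msg ω
  obtain ⟨rfl, -⟩ := he.unique he'
  by_cases h : Accepts x.n x.d x.entry (claimedCount (x.n * x.d)
      ((initState x.encode msg).mem 1)) (coinNumber ω (coinCount (x.n * x.d)))
  · exact hx ((hacc h).orthogonalVectors ho)
  · rw [hrej h] at ho
    exact ho rfl

theorem mainTheorem5 :
    ∃ (c : OVInstance → ℕ ×ₗ ℕ),
      (∀ x, (∃ y, OrthogonalVectors x y) → IsLeast {y | OrthogonalVectors x y} (c x)) ∧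
      ∃ t₁ ∈ SoftO (fun x : OVInstance => x.n * x.d),
      ∃ t₂ ∈ SoftO (fun x : OVInstance => x.n ^ 2 * x.d ^ 2),
        HasPsdMAProof OVInstance.encode decodePair OrthogonalVectors c t₁ t₂ := by
  refine ⟨canonicalPair, fun x hx => isLeast_canonicalPair hx, verifierTime, verifierTime_mem,
    proverTime, proverTime_mem, fun x hx => (isLeast_canonicalPair hx).1, verifierCmd, proverCmd,
    fun x msg ω => ?_, fun x ω => ?_, fun x hx => ?_, canonical_soundness, fun x hx msg => ?_⟩
  · obtain ⟨s, t, he, ht, -⟩ := verifier_run x msg ω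
    exact ⟨s, t, he, ht⟩
  · obtain ⟨s, t, he, ht, -⟩ := prover_run x ω
    exact ⟨s, t, he, ht⟩
  · have h : (2 / 3 : ℝ≥0∞) ≤ 1 := ENNReal.div_le_of_le_mul (by norm_num)
    exact (h.trans measure_univ.ge).trans
      (measure_mono fun ω _ => canonical_completeness x hx ω)
  · exact (measure_mono_null (fun ω h => standard_soundness x hx msg ω h) measure_empty).le.trans
      zero_le
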